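/- Let $\mathcal D$ be a parametric discrete-time Markov chain with finite state set $S$, initial state $s_I$, finitely many transition parameters, transition polynomials $\mathcal P(s,s')$ with rational coefficients, and a parameter space $V_{\mathcal D}$ all of whose points $u$ are well-defined instantiations, i.e. yield a Markov chain $\mathcal D[u]$; let $\mathbb P$ be a probability distribution on $V_{\mathcal D}$. Let $G\subseteq S$ be reached with probability one from every state in every $\mathcal D[u]$, $u \in V_{\mathcal D}$ (so that expected costs of reaching $G$ are well-defined), and let $\kappa\in\mathbb R$. Let the state costs $c(s)$, $s\in S$, be affine functions of $W$ controllable real cost parameters; $w\in\mathbb R^W$ is called admissible if $c(s)[w]\ge 0$ for all $s\in S$. For admissible $w$, the chain $\mathcal D[u]$ satisfies $\varphi_c$ under $w$ if its expected cost of reaching $G$ from $s_I$ under the costs $c[w]$ is at most $\kappa$; let $F_w(\varphi_c)=\mathbb P\{u : \mathcal D[u]\text{ satisfies }\varphi_c\text{ under }w\}$. For samples $u_1,\dots,u_K\in V_{\mathcal D}$ and a set of indices $R\subseteq\{1,\dots,K\}$, the scenario program of $R$ minimizes $\tau$ over admissible $w\in\mathbb R^W$, $\tau\in\mathbb R$ and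 $x_{k,s}\in\mathbb R$ subject to, for all $k\in R$: $x_{k,s_I}\le\tau$, $x_{k,s_I}\le\kappa$, $x_{k,s}=0$ for $s\in G$, and $x_{k,s}=c(s)[w]+\sum_{s'\in S}\mathcal P(s,s')[u_k]\,x_{k,s'}$ for $s\in S\setminus G$. If several $w$ are optimal, the one that minimizes a fixed strictly convex function $t:\mathbb R^W\to\mathbb R$ with $t(w)\to\infty$ as $\|w\|\to\infty$ (for instance $\|w\|_2^2$) is taken as the solution. Let $K\ge 2$, $L\ge 0$, $\nu\in[0,1)$ and $$\alpha_\nu=\binom{L+W+1}{L}\sum_{i=0}^{L+W+1}\binom{K}{i}(1-\nu)^{K-i}\nu^i .$$ Then, with probability at least $1-\alpha_\nu$ over independent samples $u_1,\dots,u_K$ drawn from $\mathbb P$, the following holds. Let $Q$ be the set of indices of the samples that violate $\varphi_c$ under some admissible cost instantiation $\bar w$ (which may depend on the samples, and may be the computed solution $w^*$ itself). If $|Q|\le L$ (in particular, if $|Q| = L$) and $w^*$ is the solution of the scenario program of $R=\{1,\dots,K\}\setminus Q$, then $F_{w^*}(\varphi_c)\ge 1-\nu$. -/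

import Mathlib

open MeasureTheory ProbabilityTheory
open scoped ENNReal

/-- A parametric discrete-time Markov chain with finite state type `S` and finite parameter type
`V`: an initial state, transition polynomials with rational coefficients, and a parameter space
all of whose points are well-defined instantiations. -/
structure ParametricMC (S V : Type*) [Fintype S] where
  /-- the initial state -/
  init : S
  /-- the transition polynomials -/
  trans : S → S → MvPolynomial V ℚ
  /-- the parameter space -/
  space : Set (V → ℝ)
  trans_nonneg : ∀ u ∈ space, ∀ s s', 0 ≤ MvPolynomial.aeval u (trans s s')
  trans_sum : ∀ u ∈ space, ∀ s, ∑ s', MvPolynomial.aeval u (trans s s') = 1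

namespace ParametricMC

variable {S V W : Type*} [Fintype S]

/-- The transition probability from `s` to `s'` in the chain instantiated at `u`. -/
noncomputable def prob (D : ParametricMC S V) (u : D.space) (s s' : S) : ℝ :=
  MvPolynomial.aeval (u : V → ℝ) (D.trans s s')

/-- The distribution of the successor of `s` in the chain instantiated at `u`. -/
noncomputable def row (D : ParametricMC S V) (u : D.space) (s : S) : PMF S :=
  PMF.ofFintype (fun s' => ENNReal.ofReal (D.prob u s s')) (by
    simp only [prob]
    rw [← ENNReal.ofReal_sum_of_nonneg fun s' _ => D.trans_nonneg u u.2 s s',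
      D.trans_sum u u.2 s, ENNReal.ofReal_one])

section PathMeasure

variable [MeasurableSpace S] [MeasurableSingletonClass S]

/-- The one-step transition kernel of the chain instantiated at `u`. -/
noncomputable def stepKernel (D : ParametricMC S V) (u : D.space) : Kernel S S :=
  Kernel.ofFunOfCountable fun s => (D.row u s).toMeasure

instance (D : ParametricMC S V) (u : D.space) : IsMarkovKernel (D.stepKernel u) :=
  ⟨fun s => PMF.toMeasure.isProbabilityMeasure (D.row u s)⟩

/-- The probability measure on infinite paths of the chain instantiated at `u` that is
started in `s`. -/
noncomputable def pathMeasure (D : ParametricMC S V) (u : D.space) (s : S) : Measure (ℕ → S) :=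
  Kernel.traj (X := fun _ : ℕ => S)
    (fun n => (D.stepKernel u).comap
      (fun x : (i : Finset.Iic n) → S => x ⟨n, Finset.mem_Iic.2 le_rfl⟩) (measurable_pi_apply _))
    0 (fun _ => s)

/-- Starting in any state, every instantiated chain reaches `G` with probability one; this is
what makes the expected costs of reaching `G` well-defined. -/
def ReachesAlmostSurely (D : ParametricMC S V) (G : Set S) : Prop :=
  ∀ (u : D.space) (s : S), D.pathMeasure u s {x | ∃ n, x n ∈ G} = 1

open Classical in
/-- The cost accumulated along the path `x` before `G` is visited for the first time. -/
noncomputable def pathCost (G : Set S) (c : S → ℝ) (x : ℕ → S) : ℝ≥0∞ :=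
  ∑' n, if ∀ i ≤ n, x i ∉ G then ENNReal.ofReal (c (x n)) else 0

/-- The expected cost of reaching `G` from the initial state, for the state costs `c`. -/
noncomputable def expectedCost (D : ParametricMC S V) (G : Set S) (c : S → ℝ) (u : D.space) :
    ℝ≥0∞ :=
  ∫⁻ x, pathCost G c x ∂(D.pathMeasure u D.init)

/-- The chain instantiated at `u` satisfies the expected cost specification: the expected cost of
reaching `G` is at most `κ`. -/
def Satisfies (D : ParametricMC S V) (G : Set S) (κ : ℝ) (c : S → ℝ) (u : D.space) : Prop :=
  ((D.expectedCost G c u : ℝ≥0∞) : EReal) ≤ ((κ : ℝ) : EReal)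

/-- The satisfaction probability of the expected cost specification, when the parameters are
distributed according to `P`. -/
noncomputable def satProb (D : ParametricMC S V) (P : Measure D.space) (G : Set S) (κ : ℝ)
    (c : S → ℝ) : ℝ :=
  P.real {u | D.Satisfies G κ c u}

open Classical in
/-- The (indices of the) samples whose instantiated chains violate the specification. -/
noncomputable def violating (D : ParametricMC S V) (G : Set S) (κ : ℝ) (c : S → ℝ) {K : ℕ}
    (U : Fin K → D.space) : Finset (Fin K) :=
  Finset.univ.filter fun k => ¬ D.Satisfies G κ c (U k)

end PathMeasure

/-- A cost function with parameters in `W` that is affine in these parameters. -/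
abbrev AffineCost (S W : Type*) := S → ((W → ℝ) →ᵃ[ℝ] ℝ)

/-- The state costs for the instantiation `w` of the cost parameters. -/
def AffineCost.costs (c : AffineCost S W) (w : W → ℝ) : S → ℝ := fun s => c s w

/-- The instantiation `w` of the cost parameters makes all costs nonnegative. -/
def AffineCost.Admissible (c : AffineCost S W) (w : W → ℝ) : Prop := ∀ s, 0 ≤ c s w

/-- `(w, τ, x)` is feasible for the scenario program with the samples `U k`, `k ∈ R`. The decision
variables are the cost parameters `w`, the bound `τ`, and the expected costs `x k s`. -/
structure Feasible (D : ParametricMC S V) (G : Set S) (κ : ℝ) (c : AffineCost S W) {K : ℕ}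
    (U : Fin K → D.space) (R : Finset (Fin K)) (w : W → ℝ) (τ : ℝ) (x : Fin K → S → ℝ) :
    Prop where
  admissible : c.Admissible w
  le_bound : ∀ k ∈ R, x k D.init ≤ τ
  le_threshold : ∀ k ∈ R, x k D.init ≤ κ
  eq_zero : ∀ k ∈ R, ∀ s ∈ G, x k s = 0
  eq_step : ∀ k ∈ R, ∀ s ∉ G, x k s = c s w + ∑ s', D.prob (U k) s s' * x k s'

/-- `w` is the cost-parameter part of a point that minimizes `τ` in the scenario program with the
samples `U k`, `k ∈ R`. -/
def IsOptimal (D : ParametricMC S V) (G : Set S) (κ : ℝ) (c : AffineCost S W) {K : ℕ}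
    (U : Fin K → D.space) (R : Finset (Fin K)) (w : W → ℝ) : Prop :=
  ∃ τ x, D.Feasible G κ c U R w τ x ∧ ∀ w' τ' x', D.Feasible G κ c U R w' τ' x' → τ ≤ τ'

/-- `w` is the solution of the scenario program, where `t` decides between several optimal
instantiations of the cost parameters. -/
def IsSolution (D : ParametricMC S V) (G : Set S) (κ : ℝ) (c : AffineCost S W)
    (t : (W → ℝ) → ℝ) {K : ℕ} (U : Fin K → D.space) (R : Finset (Fin K)) (w : W → ℝ) : Prop :=
  D.IsOptimal G κ c U R w ∧ ∀ w', D.IsOptimal G κ c U R w' → t w ≤ t w'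

end ParametricMC

/-- The confidence probability for `K` samples, at most `L` of them discarded, and `W` cost
parameters, at the tolerance probability `ν`. -/
noncomputable def confidenceProb (K L W : ℕ) (ν : ℝ) : ℝ :=
  ((L + W + 1).choose L : ℝ) *
    ∑ i ∈ Finset.range (L + W + 2), (K.choose i : ℝ) * (1 - ν) ^ (K - i) * ν ^ i

/-! Since `G` is reached almost surely, the expected cost solves a nonsingular linear system
(`expectedCost_eq`). It is therefore affine in `w`, and measurable in `u`. The scenario program
becomes a minimax problem: minimize the maximum of the values of the samples in `R` over the closed
convex set of admissible `w`, with `t` breaking ties. Its optimal value satisfies `τ ≤ κ`, so it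
suffices to show that the set of chains with value at most `τ` at the solution rarely has
probability below `1 - ν`.

Suppose first that the functions `F z` are strictly convex with bounded sublevel sets and that each
event `F z w = r` is null. Put `d = finrank E + 1`. A finite family contains exactly one subfamily
`I` that is tight and leaves all other members strictly below its minimax value, namely the active
functions (`existsUnique_tight`). By Helly's theorem and the null events, tight families with more
than `d` members almost surely do not occur (`tightLaw_eq_zero`). Given `I` with slack probability
`t`, the other samples fall into the slack set independently, each with probability `t`. With `μ k =
tightLaw A F P k` this yields the moment identities `∑ k, C(m,k) ∫ t^(m-k) dμ k = 1` for all `m ≥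
1`. It also bounds the probability that removing `q` violated samples out of `N + q` leaves slack
probability below `a` by `C(N+q,q) ∑ k, C(N,k) ∫_{t<a} t^(N-k) (1-t)^q dμ k`.

This bound is a linear functional of the unknown `μ k`, and it is estimated by duality
(`sum_integral_tail_le`). The identities say that `∑ k, ∫ p^(k)/k! dμ k = p(1)` for every polynomial
`p` with `p(0) = 0`, so any such `p` whose normalized derivatives dominate the integrands gives the
bound `p(1)`. A `d`-fold antiderivative of a suitable majorant makes `p(1)` arbitrarily close to
`C(q+d-1,q)` times a binomial tail. The sum over `q ≤ L` is at most `confidenceProb`.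

The expected costs are neither strictly convex nor free of atoms. They are perturbed by a small
multiple of `t` and a still smaller random shift given by a uniform label. As the perturbation
vanishes, the perturbed solutions converge to the lexicographic one, so each bad sample, with any
labels, eventually stays in the bad events of the perturbed programs. The bound passes to the limit
inferior of these events, and Fubini removes the labels. -/

namespace ParametricMC

/-! ### Expected costs as the solution of a linear system. -/

variable {S V W : Type*}

/-- The vector `g`, set to zero on `G`. -/
noncomputable def offTarget (G : Set S) (g : S → ℝ) : S → ℝ := Gᶜ.indicator g

lemma offTarget_nonneg (G : Set S) {g : S → ℝ} (hg : ∀ s, 0 ≤ g s) (s : S) :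
    0 ≤ offTarget G g s := Set.indicator_nonneg (fun s _ => hg s) s

variable [Fintype S]

open Classical in
/-- The transition matrix of the chain instantiated at `u`, restricted to the states outside `G`. -/
noncomputable def transient (D : ParametricMC S V) (G : Set S) (u : D.space) : Matrix S S ℝ :=
  fun s s' => if s ∉ G ∧ s' ∉ G then D.prob u s s' else 0

lemma prob_nonneg (D : ParametricMC S V) (u : D.space) (s s' : S) : 0 ≤ D.prob u s s' :=
  D.trans_nonneg u u.2 s s'

lemma transient_nonneg (D : ParametricMC S V) (G : Set S) (u : D.space) (s s' : S) :
    0 ≤ D.transient G u s s' := by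
  unfold transient
  split_ifs
  exacts [D.prob_nonneg u s s', le_rfl]

lemma eq_iterate {T : Matrix S S ℝ} [DecidableEq S] {x b : S → ℝ} (h : x = b + T.mulVec x) (n : ℕ) :
    x = ∑ i ∈ Finset.range n, (T ^ i).mulVec b + (T ^ n).mulVec x := by
  induction n with
  | zero => simp
  | succ n ih =>
    conv_lhs => rw [ih]
    conv_lhs => enter [2]; rw [h]
    rw [Finset.sum_range_succ, Matrix.mulVec_add, pow_succ, ← Matrix.mulVec_mulVec, add_assoc]

lemma system_iff (D : ParametricMC S V) (G : Set S) (u : D.space) (b x : S → ℝ) :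
    ((∀ s ∈ G, x s = 0) ∧ ∀ s ∉ G, x s = b s + ∑ s', D.prob u s s' * x s') ↔
      x = offTarget G b + (D.transient G u).mulVec x := by
  have key : (∀ s ∈ G, x s = 0) → ∀ s ∉ G,
      ∑ s', D.prob u s s' * x s' = (D.transient G u).mulVec x s := by
    intro h0 s hs
    refine Finset.sum_congr rfl fun s' _ => ?_
    by_cases hs' : s' ∈ G
    · simp [h0 s' hs']
    · simp [transient, hs, hs']
  have h0 : x = offTarget G b + (D.transient G u).mulVec x → ∀ s ∈ G, x s = 0 := by
    intro h s hs
    rw [h]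
    simp [offTarget, hs, Matrix.mulVec, dotProduct, transient]
  constructor
  · rintro ⟨h, h'⟩
    funext s
    by_cases hs : s ∈ G
    · rw [h s hs]
      simp [offTarget, hs, Matrix.mulVec, dotProduct, transient]
    · rw [h' s hs, key h s hs]
      simp [offTarget, hs]
  · intro h
    refine ⟨h0 h, fun s hs => ?_⟩
    rw [key (h0 h) s hs]
    conv_lhs => rw [h]
    simp [offTarget, hs]

lemma transient_pow_mulVec_nonneg [DecidableEq S] (D : ParametricMC S V) (G : Set S) (u : D.space)
    {b : S → ℝ} (hb : ∀ s, 0 ≤ b s) (n : ℕ) (s : S) :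
    0 ≤ ((D.transient G u ^ n).mulVec b) s := by
  induction n generalizing s with
  | zero => simpa using hb s
  | succ n ih =>
    rw [pow_succ', ← Matrix.mulVec_mulVec]
    exact Finset.sum_nonneg fun r _ => mul_nonneg (D.transient_nonneg _ _ _ _) (ih r)

section PathMeasure

variable [MeasurableSpace S] [MeasurableSingletonClass S]

lemma isProbabilityMeasure_pathMeasure (D : ParametricMC S V) (u : D.space) (s : S) :
    IsProbabilityMeasure (D.pathMeasure u s) := by
  unfold pathMeasure; infer_instance

lemma lintegral_stepKernel (D : ParametricMC S V) (u : D.space) (s : S) (g : S → ℝ≥0∞) :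
    ∫⁻ s', g s' ∂(D.stepKernel u s) = ∑ s', ENNReal.ofReal (D.prob u s s') * g s' := by
  rw [lintegral_fintype]
  refine Finset.sum_congr rfl fun s' _ => ?_
  rw [mul_comm]
  congr 1
  change (D.row u s).toMeasure {s'} = _
  rw [PMF.toMeasure_apply_singleton _ _ (measurableSet_singleton s')]
  rfl

/-- The Markov property: the law of the first `n + 2` states is the law of the first `n + 1` states
composed with one transition step. -/
lemma lintegral_pathMeasure_succ (D : ParametricMC S V) (u : D.space) (s : S) (n : ℕ)
    (g : ((i : Finset.Iic n) → S) → S → ℝ≥0∞) :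
    ∫⁻ x, g (Preorder.frestrictLe n x) (x (n + 1)) ∂(D.pathMeasure u s) =
      ∫⁻ x, ∑ s', ENNReal.ofReal (D.prob u (x n) s') * g (Preorder.frestrictLe n x) s'
        ∂(D.pathMeasure u s) := by
  set κ : (n : ℕ) → Kernel ((i : Finset.Iic n) → S) S := fun n => (D.stepKernel u).comap
      (fun x : (i : Finset.Iic n) → S => x ⟨n, Finset.mem_Iic.2 le_rfl⟩) (measurable_pi_apply _)
    with hκ
  have h := Kernel.partialTraj_compProd_eq_map_traj (X := fun _ : ℕ => S) (κ := κ) (a := 0)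
    (b := n) (Nat.zero_le n) (x₀ := fun _ => s)
  have hg : Measurable (Function.uncurry g) := measurable_of_countable _
  have h1 : ∫⁻ x, g (Preorder.frestrictLe n x) (x (n + 1)) ∂(D.pathMeasure u s) =
      ∫⁻ y, Function.uncurry g y ∂((Kernel.traj κ 0 (fun _ => s)).map
        (fun x : ℕ → S ↦ (Preorder.frestrictLe (π := fun _ => S) n x, x (n + 1)))) := by
    rw [lintegral_map hg (by fun_prop)]
    rfl
  rw [h1, ← h, Measure.lintegral_compProd hg, ← Kernel.traj_map_frestrictLe_apply,
    lintegral_map hg.lintegral_kernel_prod_right' (by fun_prop)]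
  refine lintegral_congr fun x => ?_
  simp only [hκ, Kernel.comap_apply, Function.uncurry_apply_pair]
  rw [lintegral_stepKernel]
  rfl

open Classical in
-- Induction on `n` with `g` arbitrary: averaging over the last step replaces `g` by its image under
-- the transient matrix and leaves a path that is shorter by one step.
lemma lintegral_survive (D : ParametricMC S V) (G : Set S) (u : D.space) (s : S) (n : ℕ)
    (g : S → ℝ) (hg : ∀ s, 0 ≤ g s) :
    ∫⁻ x, (if ∀ i ≤ n, x i ∉ G then ENNReal.ofReal (g (x n)) else 0) ∂(D.pathMeasure u s) =
      ENNReal.ofReal (((D.transient G u ^ n).mulVec (offTarget G g)) s) := by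
  induction n generalizing g with
  | zero =>
    refine (lintegral_congr (g := fun x => ENNReal.ofReal (offTarget G g (x 0)))
      fun x => ?_).trans ?_
    · by_cases h : x 0 ∈ G <;> simp [offTarget, h]
    have hm : Measurable fun x : ℕ → S => ENNReal.ofReal (offTarget G g (x 0)) :=
      (measurable_of_countable fun s => ENNReal.ofReal (offTarget G g s)).comp
        (measurable_pi_apply 0)
    have hP := isProbabilityMeasure_pathMeasure D u s
    unfold pathMeasure at hP ⊢
    have h0 : ∀ x : ℕ → S,
        Function.updateFinset x (Finset.Iic 0) (fun _ => s) 0 = s := fun x => by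
      simp [Function.updateFinset]
    rw [Kernel.lintegral_traj _ hm, lintegral_congr fun x => by rw [h0 x]]
    simp
  | succ n ih =>
    let F : ((i : Finset.Iic n) → S) → S → ℝ≥0∞ := fun y s' =>
      if ∀ i, y i ∉ G then (if s' ∉ G then ENNReal.ofReal (g s') else 0) else 0
    have h1 : ∀ x : ℕ → S, (if ∀ i ≤ n + 1, x i ∉ G then ENNReal.ofReal (g (x (n + 1))) else 0) =
        F (Preorder.frestrictLe n x) (x (n + 1)) := by
      intro x
      have : (∀ i ≤ n + 1, x i ∉ G) ↔
          (∀ i : Finset.Iic n, Preorder.frestrictLe (π := fun _ => S) n x i ∉ G) ∧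
            x (n + 1) ∉ G := by
        simp only [Preorder.frestrictLe_apply, Subtype.forall, Finset.mem_Iic]
        constructor
        · intro h
          exact ⟨fun i hi => h i (by omega), h _ le_rfl⟩
        · rintro ⟨h, h'⟩ i hi
          rcases Nat.lt_or_ge i (n + 1) with hi' | hi'
          · exact h i (by omega)
          · obtain rfl : i = n + 1 := by omega
            exact h'
      simp only [F, this, ite_and]
    have h2 : ∀ x : ℕ → S, ∑ s', ENNReal.ofReal (D.prob u (x n) s') *
          F (Preorder.frestrictLe n x) s' =
        if ∀ i ≤ n, x i ∉ G then
          ENNReal.ofReal ((D.transient G u).mulVec (offTarget G g) (x n)) else 0 := by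
      intro x
      have : (∀ i ≤ n, x i ∉ G) ↔
          ∀ i : Finset.Iic n, Preorder.frestrictLe (π := fun _ => S) n x i ∉ G := by
        simp [Preorder.frestrictLe_apply]
      simp only [F, ← this]
      split_ifs with h
      · rw [Matrix.mulVec, dotProduct, ENNReal.ofReal_sum_of_nonneg]
        · refine Finset.sum_congr rfl fun s' _ => ?_
          by_cases hs : s' ∈ G
          · simp [offTarget, hs]
          · simp only [offTarget, transient, hs, h n le_rfl, not_false_eq_true, and_self, if_true,
              Set.mem_compl_iff, Set.indicator_of_mem]
            rw [ENNReal.ofReal_mul (D.prob_nonneg _ _ _)]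
        · exact fun s' _ => mul_nonneg (D.transient_nonneg _ _ _ _) (offTarget_nonneg G hg _)
      · simp
    simp_rw [h1]
    rw [lintegral_pathMeasure_succ]
    simp_rw [h2]
    have h3 : ∀ s, 0 ≤ (D.transient G u).mulVec (offTarget G g) s := fun s =>
      Finset.sum_nonneg fun s' _ =>
        mul_nonneg (D.transient_nonneg _ _ _ _) (offTarget_nonneg G hg _)
    rw [ih _ h3]
    rw [pow_succ, ← Matrix.mulVec_mulVec]
    congr 3
    funext s'
    by_cases hs : s' ∈ G
    · simp [offTarget, hs, Matrix.mulVec, dotProduct, transient]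
    · simp [offTarget, hs]

open Classical in
-- The sum of the entries outside `G` in row `s` of the `n`-th power is the probability of avoiding
-- `G` up to time `n`. It decreases to the probability of never reaching `G`, which is zero, and it
-- dominates each of these entries.
lemma tendsto_transient_pow (D : ParametricMC S V) (G : Set S) (hG : D.ReachesAlmostSurely G)
    (u : D.space) (s s' : S) :
    Filter.Tendsto (fun n => (D.transient G u ^ n) s s') Filter.atTop (nhds 0) := by
  have hP := isProbabilityMeasure_pathMeasure D u s
  set A : ℕ → Set (ℕ → S) := fun n => {x : ℕ → S | ∀ i ≤ n, x i ∉ G} with hA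
  have hAm : ∀ n, MeasurableSet (A n) := fun n => by
    have : A n = ⋂ i, ⋂ (_ : i ≤ n), (fun x : ℕ → S => x i) ⁻¹' Gᶜ := by
      ext x; simp [hA]
    rw [this]
    exact MeasurableSet.iInter fun i => MeasurableSet.iInter fun _ =>
      (measurable_pi_apply i) (Set.toFinite _).measurableSet
  have hInter : D.pathMeasure u s (⋂ n, A n) = 0 := by
    have h1 : (⋂ n, A n) = {x | ∃ n, x n ∈ G}ᶜ := by
      ext x
      simp only [hA, Set.mem_iInter, Set.mem_ofPred_eq, Set.mem_compl_iff, not_exists]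
      exact ⟨fun h n => h n n le_rfl, fun h n i _ => h i⟩
    have h2 : MeasurableSet {x : ℕ → S | ∃ n, x n ∈ G} := by
      rw [← compl_compl {x : ℕ → S | ∃ n, x n ∈ G}, ← h1]
      exact (MeasurableSet.iInter hAm).compl
    rw [h1, prob_compl_eq_zero_iff h2]
    exact hG u s
  have hlim : Filter.Tendsto (fun n => D.pathMeasure u s (A n)) Filter.atTop (nhds 0) := by
    rw [← hInter]
    refine tendsto_measure_iInter_atTop (fun n => (hAm n).nullMeasurableSet) ?_
      ⟨0, measure_ne_top _ _⟩
    intro m n hmn x hx i hi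
    exact hx i (le_trans hi hmn)
  have hval : ∀ n, D.pathMeasure u s (A n) =
      ENNReal.ofReal (((D.transient G u ^ n).mulVec (offTarget G fun _ => 1)) s) := by
    intro n
    rw [← lintegral_survive D G u s n (fun _ => 1) fun _ => zero_le_one,
      ← lintegral_indicator_one (hAm n)]
    refine lintegral_congr fun x => ?_
    by_cases hx : ∀ i ≤ n, x i ∉ G
    · rw [if_pos hx, Set.indicator_of_mem (show x ∈ A n from hx)]; simp
    · rw [if_neg hx, Set.indicator_of_notMem (show x ∉ A n from hx)]
  have hpow : ∀ n s s', 0 ≤ (D.transient G u ^ n) s s' := by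
    intro n
    induction n with
    | zero => intro s s'; simp only [pow_zero, Matrix.one_apply]; split_ifs <;> simp
    | succ n ih =>
      intro s s'
      rw [pow_succ, Matrix.mul_apply]
      exact Finset.sum_nonneg fun r _ => mul_nonneg (ih _ _) (D.transient_nonneg _ _ _ _)
  have hlim' : Filter.Tendsto
      (fun n => ((D.transient G u ^ n).mulVec (offTarget G fun _ => 1)) s) Filter.atTop
      (nhds 0) := by
    have h := (ENNReal.tendsto_toReal ENNReal.zero_ne_top).comp hlim
    simp only [ENNReal.toReal_zero] at h
    refine h.congr fun n => ?_
    simp only [Function.comp, hval]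
    exact ENNReal.toReal_ofReal (Finset.sum_nonneg fun r _ =>
      mul_nonneg (hpow n s r) (offTarget_nonneg G (fun _ => zero_le_one) r))
  by_cases hs : s' ∈ G
  -- Columns of target states vanish only from the first power on; the zeroth power is the identity.
  · refine tendsto_const_nhds.congr' ?_
    filter_upwards [Filter.eventually_gt_atTop 0] with n hn
    obtain ⟨m, rfl⟩ := Nat.exists_eq_succ_of_ne_zero hn.ne'
    rw [pow_succ, Matrix.mul_apply]
    simp [transient, hs]
  · refine squeeze_zero (fun n => hpow n s s') (fun n => ?_) hlim'
    rw [Matrix.mulVec, dotProduct]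
    refine le_trans (le_of_eq ?_) (Finset.single_le_sum
      (f := fun r => (D.transient G u ^ n) s r * offTarget G (fun _ => 1) r)
      (fun r _ => mul_nonneg (hpow n s r) (offTarget_nonneg G (fun _ => zero_le_one) r))
      (Finset.mem_univ s'))
    simp [offTarget, hs]

open Classical in
/-- The expected costs of reaching `G` from the initial state, as the solution of a linear
system. -/
noncomputable def value (D : ParametricMC S V) (G : Set S) (c : AffineCost S W) (u : D.space)
    (w : W → ℝ) : ℝ :=
  ((1 - D.transient G u)⁻¹.mulVec (offTarget G (c.costs w))) D.init

open Classical in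
-- A vector in the kernel is fixed by the transient matrix, hence by all its powers, and these tend
-- to zero.
lemma isUnit_one_sub_transient (D : ParametricMC S V) (G : Set S) (hG : D.ReachesAlmostSurely G)
    (u : D.space) : IsUnit (1 - D.transient G u) := by
  rw [← Matrix.mulVec_injective_iff_isUnit]
  refine (injective_iff_map_eq_zero (Matrix.mulVecLin (1 - D.transient G u))).2 fun x hx => ?_
  have hx' : x = 0 + (D.transient G u).mulVec x := by
    rw [Matrix.mulVecLin_apply, Matrix.sub_mulVec, Matrix.one_mulVec, sub_eq_zero] at hx
    rwa [zero_add]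
  funext s
  have h : Filter.Tendsto (fun n => ((D.transient G u ^ n).mulVec x) s) Filter.atTop
      (nhds (∑ s', 0 * x s')) :=
    tendsto_finsetSum _ fun s' _ => (D.tendsto_transient_pow G hG u s s').mul_const _
  have h' : ∀ n, ((D.transient G u ^ n).mulVec x) s = x s := by
    intro n
    conv_rhs => rw [eq_iterate hx' n]
    simp
  simp only [h', zero_mul, Finset.sum_const_zero] at h
  exact tendsto_nhds_unique tendsto_const_nhds h

open Classical in
lemma eq_offTarget_add_iff (D : ParametricMC S V) (G : Set S) (hG : D.ReachesAlmostSurely G)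
    (u : D.space) (b x : S → ℝ) :
    x = offTarget G b + (D.transient G u).mulVec x ↔
      x = (1 - D.transient G u)⁻¹.mulVec (offTarget G b) := by
  have hU := (Matrix.isUnit_iff_isUnit_det _).1 (D.isUnit_one_sub_transient G hG u)
  have h1 : x = offTarget G b + (D.transient G u).mulVec x ↔
      (1 - D.transient G u).mulVec x = offTarget G b := by
    rw [Matrix.sub_mulVec, Matrix.one_mulVec, sub_eq_iff_eq_add]
  rw [h1]
  constructor
  · intro h
    rw [← h, Matrix.mulVec_mulVec, Matrix.nonsing_inv_mul _ hU, Matrix.one_mulVec]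
  · rintro rfl
    rw [Matrix.mulVec_mulVec, Matrix.mul_nonsing_inv _ hU, Matrix.one_mulVec]

lemma expectedCost_eq (D : ParametricMC S V) (G : Set S) (hG : D.ReachesAlmostSurely G)
    (c : AffineCost S W) (u : D.space) {w : W → ℝ} (hw : c.Admissible w) :
    D.expectedCost G (c.costs w) u = ENNReal.ofReal (D.value G c u w) ∧ 0 ≤ D.value G c u w := by
  classical
  set b := offTarget G (c.costs w)
  have hb : ∀ s, 0 ≤ b s := offTarget_nonneg G hw
  set x := (1 - D.transient G u)⁻¹.mulVec b with hx
  have hit := eq_iterate ((D.eq_offTarget_add_iff G hG u _ x).2 hx)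
  -- The Neumann series: its partial sums differ from the solution by the image of the solution
  -- under a power of the transient matrix. Its `n`-th term is the expected cost incurred at time
  -- `n`.
  have hs : HasSum (fun n => ((D.transient G u ^ n).mulVec b) D.init) (x D.init) := by
    rw [hasSum_iff_tendsto_nat_of_nonneg fun n => D.transient_pow_mulVec_nonneg G u hb n _]
    have h : Filter.Tendsto (fun n => ((D.transient G u ^ n).mulVec x) D.init) Filter.atTop
        (nhds (∑ s', 0 * x s')) :=
      tendsto_finsetSum _ fun s' _ => (D.tendsto_transient_pow G hG u D.init s').mul_const _
    have h2 := h.const_sub (x D.init)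
    simp only [zero_mul, Finset.sum_const_zero, sub_zero] at h2
    refine h2.congr fun n => ?_
    have h3 := congrFun (hit n) D.init
    simp only [Pi.add_apply, Finset.sum_apply] at h3
    rw [sub_eq_iff_eq_add]
    exact h3
  have hval : D.value G c u w = x D.init := by
    simp only [value, hx, b]
  have hnn : 0 ≤ x D.init := hs.nonneg fun n => D.transient_pow_mulVec_nonneg G u hb n _
  rw [hval]
  refine ⟨?_, hnn⟩
  unfold expectedCost pathCost
  rw [lintegral_tsum]
  · rw [← hs.tsum_eq, ENNReal.ofReal_tsum_of_nonneg
      (fun n => D.transient_pow_mulVec_nonneg G u hb n _) hs.summable]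
    exact tsum_congr fun n => by
      rw [← D.lintegral_survive G u D.init n (c.costs w) hw]
  · intro n
    refine (Measurable.ite ?_ ?_ measurable_const).aemeasurable
    · have : {x : ℕ → S | ∀ i ≤ n, x i ∉ G} =
          ⋂ i, ⋂ (_ : i ≤ n), (fun x : ℕ → S => x i) ⁻¹' Gᶜ := by
        ext x; simp
      rw [this]
      exact MeasurableSet.iInter fun i => MeasurableSet.iInter fun _ =>
        (measurable_pi_apply i) (Set.toFinite _).measurableSet
    · exact (measurable_of_countable fun s => ENNReal.ofReal (c.costs w s)).comp
        (measurable_pi_apply n)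

lemma satisfies_iff (D : ParametricMC S V) (G : Set S) (hG : D.ReachesAlmostSurely G) (κ : ℝ)
    (c : AffineCost S W) (u : D.space) {w : W → ℝ} (hw : c.Admissible w) :
    D.Satisfies G κ (c.costs w) u ↔ D.value G c u w ≤ κ := by
  obtain ⟨h1, h2⟩ := D.expectedCost_eq G hG c u hw
  rw [Satisfies, h1, EReal.coe_ennreal_ofReal, max_eq_left h2, EReal.coe_le_coe_iff]

lemma feasible_iff (D : ParametricMC S V) (G : Set S) (hG : D.ReachesAlmostSurely G) (κ : ℝ)
    (c : AffineCost S W) {K : ℕ} (U : Fin K → D.space) (R : Finset (Fin K)) (w : W → ℝ) (τ : ℝ) :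
    (∃ x, D.Feasible G κ c U R w τ x) ↔
      c.Admissible w ∧ ∀ k ∈ R, D.value G c (U k) w ≤ τ ∧ D.value G c (U k) w ≤ κ := by
  classical
  constructor
  · rintro ⟨x, h⟩
    refine ⟨h.admissible, fun k hk => ?_⟩
    have := (D.eq_offTarget_add_iff G hG (U k) _ _).1
      ((D.system_iff G (U k) (c.costs w) (x k)).1 ⟨h.eq_zero k hk, h.eq_step k hk⟩)
    have hv : D.value G c (U k) w = x k D.init := by rw [this]; rfl
    rw [hv]
    exact ⟨h.le_bound k hk, h.le_threshold k hk⟩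
  · rintro ⟨hw, h⟩
    set x : Fin K → S → ℝ := fun k => (1 - D.transient G (U k))⁻¹.mulVec (offTarget G (c.costs w))
    have hx : ∀ k, _ := fun k => (D.system_iff G (U k) (c.costs w) (x k)).2
      ((D.eq_offTarget_add_iff G hG (U k) _ (x k)).2 rfl)
    have hv : ∀ k, D.value G c (U k) w = x k D.init := fun k => rfl
    exact ⟨x, hw, fun k hk => hv k ▸ (h k hk).1, fun k hk => hv k ▸ (h k hk).2,
      fun k _ => (hx k).1, fun k _ => (hx k).2⟩

end PathMeasure

/-! ### Dependence of the expected cost on the cost and transition parameters. -/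

lemma value_combo (D : ParametricMC S V) (G : Set S) (c : AffineCost S W) (u : D.space)
    (w w' : W → ℝ) {a b : ℝ} (hab : a + b = 1) :
    D.value G c u (a • w + b • w') = a * D.value G c u w + b * D.value G c u w' := by
  classical
  have : offTarget G (c.costs (a • w + b • w')) =
      a • offTarget G (c.costs w) + b • offTarget G (c.costs w') := by
    funext s
    by_cases hs : s ∈ G
    · simp [offTarget, hs]
    · simp [offTarget, hs, AffineCost.costs, Convex.combo_affine_apply hab]
  simp only [value, this, Matrix.mulVec_add, Matrix.mulVec_smul, Pi.add_apply, Pi.smul_apply,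
    smul_eq_mul]

lemma convexOn_value (D : ParametricMC S V) (G : Set S) (c : AffineCost S W) (u : D.space) :
    ConvexOn ℝ Set.univ (D.value G c u) :=
  ⟨convex_univ, fun w _ w' _ _ _ _ _ hab => by
    rw [D.value_combo G c u w w' hab, smul_eq_mul, smul_eq_mul]⟩

lemma continuous_prob (D : ParametricMC S V) (s s' : S) : Continuous fun u => D.prob u s s' := by
  unfold prob
  have : ∀ p : MvPolynomial V ℚ, Continuous fun u : V → ℝ => MvPolynomial.aeval u p := by
    intro p
    simp only [MvPolynomial.aeval_def, MvPolynomial.eval₂_eq]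
    fun_prop
  exact (this _).comp continuous_subtype_val

/-- By Cramer's rule the value is a combination of quotients of continuous functions of `u`. -/
lemma measurable_value [Finite V] (D : ParametricMC S V) (G : Set S) (c : AffineCost S W)
    (w : W → ℝ) :
    Measurable fun u => D.value G c u w := by
  classical
  have hT : Continuous fun u : D.space => 1 - D.transient G u := by
    refine continuous_const.sub (continuous_pi fun s => continuous_pi fun s' => ?_)
    unfold transient
    split_ifs
    exacts [D.continuous_prob s s', continuous_const]
  unfold value Matrix.mulVec dotProduct
  refine Finset.measurable_sum _ fun s _ => Measurable.mul_const ?_ _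
  simp only [Matrix.inv_def, Ring.inverse_eq_inv', Matrix.smul_apply, smul_eq_mul]
  have hdet := (hT.matrix_det).measurable
  have hadj : Continuous fun u : D.space => (1 - D.transient G u).adjugate D.init s :=
    hT.matrix_adjugate.matrix_elem _ _
  exact hdet.inv.mul hadj.measurable

end ParametricMC

/-! ### Minimax problems for strictly convex functions. -/

/-- The point `p.1` of `A` minimizes the maximum of the functions `F z`, `z ∈ T`, and `p.2` is
the minimal value. -/
structure IsMinimax {Z E : Type*} (A : Set E) (F : Z → E → ℝ) (T : Set Z) (p : E × ℝ) : Prop where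
  mem : p.1 ∈ A
  le : ∀ z ∈ T, F z p.1 ≤ p.2
  exists_ge : ∀ w ∈ A, ∃ z ∈ T, p.2 ≤ F z w

/-- A family of continuous, strictly convex functions with bounded sublevel sets on a nonempty
closed convex set. -/
structure IsConvexProgram {Z E : Type*} [NormedAddCommGroup E] [NormedSpace ℝ E]
    (A : Set E) (F : Z → E → ℝ) : Prop where
  isClosed : IsClosed A
  nonempty : A.Nonempty
  strictConvexOn : ∀ z, StrictConvexOn ℝ A (F z)
  continuous : ∀ z, Continuous (F z)
  isBounded : ∀ z M, Bornology.IsBounded {w ∈ A | F z w ≤ M}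

namespace IsMinimax

variable {Z E : Type*} {A : Set E} {F : Z → E → ℝ}

lemma of_subset {T T' : Set Z} {p : E × ℝ} (h : IsMinimax A F T p) (hT : T ⊆ T')
    (hle : ∀ z ∈ T', F z p.1 ≤ p.2) : IsMinimax A F T' p :=
  ⟨h.mem, hle, fun w hw => let ⟨z, hz, hz'⟩ := h.exists_ge w hw; ⟨z, hT hz, hz'⟩⟩

lemma snd_le {T T' : Set Z} {p q : E × ℝ} (h : IsMinimax A F T p) (h' : IsMinimax A F T' q)
    (hT : T ⊆ T') : p.2 ≤ q.2 := by
  obtain ⟨z, hz, hz'⟩ := h.exists_ge q.1 h'.mem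
  exact hz'.trans (h'.le z (hT hz))

end IsMinimax

namespace IsConvexProgram

variable {Z E : Type*} [NormedAddCommGroup E] [NormedSpace ℝ E] {A : Set E} {F : Z → E → ℝ}

/-- At the midpoint of two distinct minimizers every function would be strictly below the common
minimal value. -/
lemma minimax_unique (hF : IsConvexProgram A F) {T : Set Z} {p q : E × ℝ}
    (hp : IsMinimax A F T p) (hq : IsMinimax A F T q) : p = q := by
  have h2 : p.2 = q.2 := le_antisymm (hp.snd_le hq subset_rfl) (hq.snd_le hp subset_rfl)
  refine Prod.ext ?_ h2
  by_contra hne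
  have hA : Convex ℝ A := by
    obtain ⟨z, -, -⟩ := hp.exists_ge p.1 hp.mem
    exact (hF.strictConvexOn z).1
  obtain ⟨z, hz, hle⟩ := hp.exists_ge ((1 / 2 : ℝ) • p.1 + (1 / 2 : ℝ) • q.1)
    (hA hp.mem hq.mem (by norm_num) (by norm_num) (by norm_num))
  have := (hF.strictConvexOn z).2 hp.mem hq.mem hne
    (show (0 : ℝ) < 1 / 2 by norm_num) (show (0 : ℝ) < 1 / 2 by norm_num) (by norm_num)
  have h3 := hp.le z hz
  have h4 := hq.le z hz
  simp only [smul_eq_mul] at this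
  linarith

lemma exists_minimax [ProperSpace E] (hF : IsConvexProgram A F) {T : Set Z} (hT : T.Finite)
    (hne : T.Nonempty) : ∃ p, IsMinimax A F T p := by
  have hne' : hT.toFinset.Nonempty := by simpa using hne
  set h : E → ℝ := fun w => hT.toFinset.sup' hne' fun z => F z w with hh
  have hc : Continuous h := Continuous.finset_sup'_apply _ fun z _ => hF.continuous z
  obtain ⟨z₀, hz₀⟩ := hne
  obtain ⟨w₀, hw₀⟩ := hF.nonempty
  have hle : ∀ w, ∀ z ∈ T, F z w ≤ h w := fun w z hz =>
    Finset.le_sup' (fun z => F z w) (by simpa using hz)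
  have hcpt : IsCompact {w ∈ A | h w ≤ h w₀} := by
    refine Metric.isCompact_of_isClosed_isBounded ?_ ?_
    · exact hF.isClosed.inter (isClosed_le hc continuous_const)
    · exact (hF.isBounded z₀ (h w₀)).subset fun w hw => ⟨hw.1, (hle w z₀ hz₀).trans hw.2⟩
  obtain ⟨w, hw, hmin⟩ := hcpt.exists_isMinOn ⟨w₀, hw₀, le_rfl⟩ hc.continuousOn
  refine ⟨(w, h w), hw.1, hle w, fun w' hw' => ?_⟩
  have h1 : h w ≤ h w' := by
    rcases le_total (h w') (h w₀) with hl | hl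
    · exact hmin ⟨hw', hl⟩
    · exact hw.2.trans hl
  obtain ⟨z, hz, hz'⟩ := Finset.exists_mem_eq_sup' hne' fun z => F z w'
  exact ⟨z, by simpa using hz, h1.trans_eq hz'⟩

/-- If some `w` were better for all active functions, a short move from the minimizer towards `w`
would lower these by convexity and keep the inactive ones below the value by continuity. -/
lemma minimax_active (hF : IsConvexProgram A F) {T : Set Z} (hT : T.Finite) {p : E × ℝ}
    (hp : IsMinimax A F T p) : IsMinimax A F {z ∈ T | F z p.1 = p.2} p := by
  refine ⟨hp.mem, fun z hz => hp.le z hz.1, fun w hw => ?_⟩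
  by_contra! hcon
  have hev : ∀ᶠ ε : ℝ in nhdsWithin 0 (Set.Ioi 0), ∀ z ∈ T,
      F z ((1 - ε) • p.1 + ε • w) < p.2 := by
    rw [Filter.eventually_all_finite hT]
    intro z hz
    rcases (hp.le z hz).lt_or_eq with hlt | heq
    · have hc : Continuous fun ε : ℝ => F z ((1 - ε) • p.1 + ε • w) :=
        (hF.continuous z).comp (by fun_prop)
      have h0 := hc.tendsto 0
      simp only [sub_zero, one_smul, zero_smul, add_zero] at h0
      exact (h0.mono_left nhdsWithin_le_nhds).eventually_lt_const hlt
    · have hl := hcon z ⟨hz, heq⟩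
      filter_upwards [Ioo_mem_nhdsGT (zero_lt_one' ℝ)] with ε hε
      have := (hF.strictConvexOn z).convexOn.2 hp.mem hw
        (show (0 : ℝ) ≤ 1 - ε by linarith [hε.2]) hε.1.le (by ring)
      simp only [smul_eq_mul] at this
      nlinarith [mul_lt_mul_of_pos_left hl hε.1]
  obtain ⟨ε, hε, hε'⟩ := (hev.and (Ioo_mem_nhdsGT (zero_lt_one' ℝ))).exists
  obtain ⟨z, hz, hle⟩ := hp.exists_ge ((1 - ε) • p.1 + ε • w)
    ((hF.strictConvexOn (hp.exists_ge w hw).choose).1 hp.mem hw (by linarith [hε'.2]) hε'.1.le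
      (by ring))
  exact absurd (hε z hz) (not_lt.2 hle)

/-- At most `finrank E + 1` of the functions are needed to determine the minimax value. -/
lemma exists_minimax_erase [FiniteDimensional ℝ E] [ProperSpace E] {ι : Type*} [DecidableEq ι]
    (hF : IsConvexProgram A F) (z : ι → Z)
    {I : Finset ι} (hI : Module.finrank ℝ E + 1 < I.card) {p : E × ℝ}
    (hp : IsMinimax A F (z '' I) p) : ∃ i ∈ I, IsMinimax A F (z '' (I.erase i)) p := by
  by_contra! hcon
  have hex : ∀ i ∈ I, ∃ q, IsMinimax A F (z '' (I.erase i)) q ∧ q.2 < p.2 := by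
    intro i hi
    have hne : (I.erase i).Nonempty := by
      rw [← Finset.card_pos, Finset.card_erase_of_mem hi]; omega
    obtain ⟨q, hq⟩ := hF.exists_minimax (T := z '' (I.erase i)) ((Finset.finite_toSet _).image z)
      (hne.to_set.image z)
    have hsub : z '' (I.erase i : Finset ι) ⊆ z '' I :=
      Set.image_mono (by simp)
    refine ⟨q, hq, lt_of_le_of_ne (hq.snd_le hp hsub) fun heq => hcon i hi ?_⟩
    exact ⟨hp.mem, fun y hy => hp.le y (hsub hy), fun w hw => heq ▸ hq.exists_ge w hw⟩
  choose! q hq hlt using hex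
  -- If every deletion lowers the value, then `finrank + 1` of the strict sublevel sets always meet:
  -- some index `i` is left out, and the minimizer without `i` lies in all of them. Helly's theorem
  -- gives a common point, which contradicts the minimax value.
  obtain ⟨w, hw⟩ := Convex.helly_theorem (𝕜 := ℝ) (s := I)
    (F := fun i => {w ∈ A | F (z i) w < p.2}) hI.le
    (fun i _ => (hF.strictConvexOn (z i)).convexOn.convex_lt p.2) (by
      intro J hJ hcard
      obtain ⟨i, hi, hiJ⟩ := Finset.exists_mem_notMem_of_card_lt_card (hcard ▸ hI)
      refine ⟨(q i).1, ?_⟩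
      simp only [Set.mem_iInter]
      intro j hj
      refine ⟨(hq i hi).mem, lt_of_le_of_lt ((hq i hi).le (z j) ⟨j, ?_, rfl⟩) (hlt i hi)⟩
      simp only [Finset.coe_erase, Set.mem_sdiff, Set.mem_singleton_iff]
      exact ⟨hJ hj, fun h => hiJ (h ▸ hj)⟩)
  simp only [Set.mem_iInter] at hw
  obtain ⟨i, hi⟩ : I.Nonempty := by rw [← Finset.card_pos]; omega
  obtain ⟨y, ⟨j, hj, rfl⟩, hle⟩ := hp.exists_ge w (hw i hi).1
  exact absurd (hw j hj).2 (not_lt.2 hle)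

end IsConvexProgram

open Classical in
/-- The minimizer and the minimal value of the maximum of the functions `F z`, `z ∈ T`, on `A`. -/
noncomputable def minimax {Z E : Type*} [Zero E] (A : Set E) (F : Z → E → ℝ) (T : Set Z) : E × ℝ :=
  if h : ∃ p, IsMinimax A F T p then h.choose else (0, 0)

/-- All functions `F z`, `z ∈ T`, attain the minimax value at the minimizer. -/
def IsTight {Z E : Type*} [Zero E] (A : Set E) (F : Z → E → ℝ) (T : Set Z) : Prop :=
  ∀ z ∈ T, F z (minimax A F T).1 = (minimax A F T).2

/-- The functions that stay strictly below the minimax value of `T` at the minimizer. -/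
def slackSet {Z E : Type*} [Zero E] (A : Set E) (F : Z → E → ℝ) (T : Set Z) : Set Z :=
  {y | F y (minimax A F T).1 < (minimax A F T).2}

namespace IsConvexProgram

variable {Z E : Type*} [NormedAddCommGroup E] [NormedSpace ℝ E] {A : Set E} {F : Z → E → ℝ}

lemma isMinimax_minimax [ProperSpace E] (hF : IsConvexProgram A F) {T : Set Z} (hT : T.Finite)
    (hne : T.Nonempty) : IsMinimax A F T (minimax A F T) := by
  unfold minimax
  rw [dif_pos (hF.exists_minimax hT hne)]
  exact (hF.exists_minimax hT hne).choose_spec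

lemma minimax_eq [ProperSpace E] (hF : IsConvexProgram A F) {T : Set Z} (hT : T.Finite)
    (hne : T.Nonempty) {p : E × ℝ} (hp : IsMinimax A F T p) : minimax A F T = p :=
  hF.minimax_unique (hF.isMinimax_minimax hT hne) hp

lemma minimax_eq_of_isTight [ProperSpace E] (hF : IsConvexProgram A F) {ι : Type*} (z : ι → Z)
    {I R : Finset ι} (hI : I.Nonempty) (hIR : I ⊆ R) (htight : IsTight A F (z '' I))
    (hslack : ∀ j ∈ R, j ∉ I → z j ∈ slackSet A F (z '' I)) :
    minimax A F (z '' R) = minimax A F (z '' I) := by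
  have hp := hF.isMinimax_minimax (I.finite_toSet.image z) (hI.to_set.image z)
  refine hF.minimax_eq (R.finite_toSet.image z) ((hI.mono hIR).to_set.image z)
    (hp.of_subset (Set.image_mono hIR) ?_)
  rintro _ ⟨j, hj, rfl⟩
  by_cases hjI : j ∈ I
  · exact (htight _ ⟨j, hjI, rfl⟩).le
  · exact (hslack j hj hjI).le

/-- Every nonempty finite family contains exactly one tight subfamily that leaves all other members
strictly below its minimax value. -/
lemma existsUnique_tight [ProperSpace E] (hF : IsConvexProgram A F) {ι : Type*} (z : ι → Z)
    {R : Finset ι} (hR : R.Nonempty) :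
    ∃! I : Finset ι, I ⊆ R ∧ I.Nonempty ∧ IsTight A F (z '' I) ∧
      ∀ j ∈ R, j ∉ I → z j ∈ slackSet A F (z '' I) := by
  classical
  have hfin : ∀ I : Finset ι, (z '' I).Finite := fun I => I.finite_toSet.image z
  have hp := hF.isMinimax_minimax (hfin R) (hR.to_set.image z)
  set p := minimax A F (z '' R) with hpdef
  set I := R.filter fun i => F (z i) p.1 = p.2 with hI
  have hact : z '' I = {y ∈ z '' R | F y p.1 = p.2} := by
    ext y
    simp only [hI, Finset.coe_filter, Set.mem_image, Set.mem_ofPred_eq]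
    constructor
    · rintro ⟨i, ⟨hi, hi'⟩, rfl⟩; exact ⟨⟨i, hi, rfl⟩, hi'⟩
    · rintro ⟨⟨i, hi, rfl⟩, hi'⟩; exact ⟨i, ⟨hi, hi'⟩, rfl⟩
  have hpI : IsMinimax A F (z '' I) p := hact ▸ hF.minimax_active (hfin R) hp
  have hIne : I.Nonempty := by
    obtain ⟨_, ⟨i, hi, rfl⟩, -⟩ := hpI.exists_ge p.1 hpI.mem
    exact ⟨i, hi⟩
  have heqI : minimax A F (z '' I) = p := hF.minimax_eq (hfin I) (hIne.to_set.image z) hpI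
  refine ⟨I, ⟨Finset.filter_subset _ _, hIne, ?_, ?_⟩, ?_⟩
  · rintro _ ⟨i, hi, rfl⟩
    rw [heqI]
    exact (Finset.mem_filter.1 hi).2
  · intro j hj hjI
    change F (z j) _ < _
    rw [heqI]
    exact lt_of_le_of_ne (hp.le _ ⟨j, hj, rfl⟩) fun h => hjI (Finset.mem_filter.2 ⟨hj, h⟩)
  · rintro J ⟨hJR, hJne, htight, hslack⟩
    have heq : p = minimax A F (z '' J) := hF.minimax_eq_of_isTight z hJne hJR htight hslack
    ext i
    rw [hI, Finset.mem_filter, heq]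
    refine ⟨fun hi => ⟨hJR hi, htight _ ⟨i, hi, rfl⟩⟩, fun hi => ?_⟩
    by_contra hiJ
    exact absurd hi.2 (hslack i hi.1 hiJ).ne

/-! ### Measurability of the minimax value and minimizer. -/

section Measurability

variable [MeasurableSpace Z] [ProperSpace E]

lemma measurable_minimax_snd (hF : IsConvexProgram A F) (hm : ∀ w, Measurable fun z => F z w)
    {ι : Type*} [Finite ι] [Nonempty ι] :
    Measurable fun z : ι → Z => (minimax A F (Set.range z)).2 := by
  have hp : ∀ z : ι → Z, IsMinimax A F (Set.range z) (minimax A F (Set.range z)) := fun z =>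
    hF.isMinimax_minimax (Set.finite_range z) (Set.range_nonempty z)
  obtain ⟨C, hCA, hC, hAC⟩ :=
    (TopologicalSpace.IsSeparable.of_separableSpace A).exists_countable_dense_subset
  refine measurable_of_Iio fun r => ?_
  -- By continuity, a value below `r` is witnessed in a countable dense subset of `A`.
  have : (fun z : ι → Z => (minimax A F (Set.range z)).2) ⁻¹' Set.Iio r =
      ⋃ w ∈ C, ⋂ i, {z : ι → Z | F (z i) w < r} := by
    ext z
    simp only [Set.mem_preimage, Set.mem_Iio, Set.mem_iUnion, Set.mem_iInter, Set.mem_ofPred_eq,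
      exists_prop]
    constructor
    · intro h
      have hopen : IsOpen {w | ∀ i, F (z i) w < r} := by
        rw [Set.ofPred_forall]
        exact isOpen_iInter_of_finite fun i => isOpen_lt (hF.continuous _) continuous_const
      obtain ⟨w, hw, hwC⟩ := mem_closure_iff.1 (hAC (hp z).mem) _ hopen
        fun i => ((hp z).le _ ⟨i, rfl⟩).trans_lt h
      exact ⟨w, hwC, hw⟩
    · rintro ⟨w, hwC, hw⟩
      obtain ⟨_, ⟨i, rfl⟩, hi⟩ := (hp z).exists_ge w (hCA hwC)
      exact hi.trans_lt (hw i)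
  rw [this]
  exact MeasurableSet.biUnion hC fun w _ => MeasurableSet.iInter fun i =>
    measurableSet_lt ((hm w).comp (measurable_pi_apply i)) measurable_const

variable [MeasurableSpace E] [BorelSpace E]

lemma measurable_minimax_fst (hF : IsConvexProgram A F) (hm : ∀ w, Measurable fun z => F z w)
    {ι : Type*} [Finite ι] [Nonempty ι] :
    Measurable fun z : ι → Z => (minimax A F (Set.range z)).1 := by
  have hp : ∀ z : ι → Z, IsMinimax A F (Set.range z) (minimax A F (Set.range z)) := fun z =>
    hF.isMinimax_minimax (Set.finite_range z) (Set.range_nonempty z)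
  refine measurable_of_isClosed fun B hB => ?_
  obtain ⟨C, hCA, hC, hAC⟩ :=
    (TopologicalSpace.IsSeparable.of_separableSpace (B ∩ A)).exists_countable_dense_subset
  -- The minimizer lies in `B` exactly when a countable dense subset of `B ∩ A` contains
  -- almost-minimizers of every accuracy. These have a limit point by compactness, which is the
  -- minimizer by uniqueness.
  have : (fun z : ι → Z => (minimax A F (Set.range z)).1) ⁻¹' B =
      ⋂ n : ℕ, ⋃ w ∈ C, ⋂ i,
        {z : ι → Z | F (z i) w < (minimax A F (Set.range z)).2 + 1 / (n + 1)} := by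
    ext z
    simp only [Set.mem_preimage, Set.mem_iUnion, Set.mem_iInter, Set.mem_ofPred_eq, exists_prop]
    set p := minimax A F (Set.range z)
    constructor
    · intro h n
      have hopen : IsOpen {w | ∀ i, F (z i) w < p.2 + 1 / (n + 1)} := by
        rw [Set.ofPred_forall]
        exact isOpen_iInter_of_finite fun i => isOpen_lt (hF.continuous _) continuous_const
      obtain ⟨w, hw, hwC⟩ := mem_closure_iff.1 (hAC ⟨h, (hp z).mem⟩) _ hopen
        fun i => ((hp z).le _ ⟨i, rfl⟩).trans_lt (lt_add_of_pos_right _ Nat.one_div_pos_of_nat)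
      exact ⟨w, hwC, hw⟩
    · intro h
      choose w hwC hw using h
      obtain ⟨i₀⟩ := ‹Nonempty ι›
      have hcpt : IsCompact (B ∩ {w ∈ A | F (z i₀) w ≤ p.2 + 1}) := by
        refine (Metric.isCompact_of_isClosed_isBounded ?_ (hF.isBounded _ _)).inter_left hB
        exact hF.isClosed.inter (isClosed_le (hF.continuous _) continuous_const)
      obtain ⟨v, hv, φ, hφ, hlim⟩ := hcpt.tendsto_subseq (x := w) fun n =>
        ⟨(hCA (hwC n)).1, (hCA (hwC n)).2, (hw n i₀).le.trans (by
          have := Nat.one_div_le_one_div (α := ℝ) (Nat.zero_le n)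
          simp only [Nat.cast_zero, zero_add, div_one] at this
          linarith)⟩
      have hmin : IsMinimax A F (Set.range z) (v, p.2) := by
        refine ⟨hv.2.1, ?_, (hp z).exists_ge⟩
        rintro _ ⟨i, rfl⟩
        have h1 : Filter.Tendsto (fun n => F (z i) (w (φ n))) Filter.atTop (nhds (F (z i) v)) :=
          ((hF.continuous (z i)).tendsto v).comp hlim
        have h2 : Filter.Tendsto (fun n : ℕ => p.2 + 1 / ((φ n : ℝ) + 1)) Filter.atTop
            (nhds (p.2 + 0)) :=
          (tendsto_one_div_add_atTop_nhds_zero_nat.comp hφ.tendsto_atTop).const_add _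
        rw [add_zero] at h2
        exact le_of_tendsto_of_tendsto' h1 h2 fun n => (hw (φ n) i).le
      have hpv : p = (v, p.2) := hF.minimax_unique (hp z) hmin
      rw [hpv]
      exact hv.1
  rw [this]
  exact MeasurableSet.iInter fun n => MeasurableSet.biUnion hC fun w _ => MeasurableSet.iInter
    fun i => measurableSet_lt ((hm w).comp (measurable_pi_apply i))
      ((hF.measurable_minimax_snd hm).add_const _)

lemma measurable_eval_minimax [SecondCountableTopology E] (hF : IsConvexProgram A F)
    (hm : ∀ w, Measurable fun z => F z w)
    {ι : Type*} [Finite ι] [Nonempty ι] :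
    Measurable fun q : (ι → Z) × Z => F q.2 (minimax A F (Set.range q.1)).1 := by
  have h := measurable_uncurry_of_continuous_of_measurable (u := fun w z => F z w)
    hF.continuous hm
  exact h.comp (((hF.measurable_minimax_fst hm).comp measurable_fst).prodMk measurable_snd)

lemma measurableSet_isTight [SecondCountableTopology E] (hF : IsConvexProgram A F)
    (hm : ∀ w, Measurable fun z => F z w)
    {ι : Type*} [Finite ι] [Nonempty ι] :
    MeasurableSet {z : ι → Z | IsTight A F (Set.range z)} := by
  have : {z : ι → Z | IsTight A F (Set.range z)} = ⋂ i, {z : ι → Z |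
      F (z i) (minimax A F (Set.range z)).1 = (minimax A F (Set.range z)).2} := by
    ext z; simp [IsTight]
  rw [this]
  refine MeasurableSet.iInter fun i => measurableSet_eq_fun ?_ (hF.measurable_minimax_snd hm)
  exact (hF.measurable_eval_minimax hm).comp (measurable_id.prodMk (measurable_pi_apply i))

lemma measurableSet_mem_slackSet [SecondCountableTopology E] (hF : IsConvexProgram A F)
    (hm : ∀ w, Measurable fun z => F z w)
    {ι : Type*} [Finite ι] [Nonempty ι] :
    MeasurableSet {q : (ι → Z) × Z | q.2 ∈ slackSet A F (Set.range q.1)} :=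
  measurableSet_lt (hF.measurable_eval_minimax hm)
    ((hF.measurable_minimax_snd hm).comp measurable_fst)

end Measurability

end IsConvexProgram

/-! ### The law of the slack probability on tight families. -/

lemma lintegral_pi_range_congr {Z : Type*} [MeasurableSpace Z] (P : Measure Z) [SigmaFinite P]
    {ι ι' : Type*} [Fintype ι] [Fintype ι'] (e : ι ≃ ι') (g : Set Z → ℝ≥0∞) :
    ∫⁻ x, g (Set.range x) ∂(Measure.pi fun _ : ι => P) =
      ∫⁻ x, g (Set.range x) ∂(Measure.pi fun _ : ι' => P) := by
  rw [← (measurePreserving_piCongrLeft (fun _ : ι' => P) e).lintegral_comp_emb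
    (MeasurableEquiv.measurableEmbedding _)]
  refine lintegral_congr fun x => ?_
  congr 1
  have : (MeasurableEquiv.piCongrLeft (fun _ : ι' => Z) e) x = x ∘ e.symm := by
    funext i
    obtain ⟨j, rfl⟩ := e.surjective i
    rw [MeasurableEquiv.coe_piCongrLeft, Equiv.piCongrLeft_apply_apply]
    simp
  rw [this, e.symm.surjective.range_comp]

lemma sum_nonempty_card {α : Type*} (f : ℕ → ℝ≥0∞) (s : Finset α) :
    ∑ I ∈ s.powerset.filter Finset.Nonempty, f I.card =
      ∑ k ∈ Finset.Icc 1 s.card, (s.card.choose k : ℝ≥0∞) * f k := by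
  have h := Finset.sum_powerset_apply_card (x := s) (fun k => if k = 0 then 0 else f k)
  rw [Finset.sum_filter]
  calc _ = ∑ I ∈ s.powerset, if I.card = 0 then 0 else f I.card := by
        refine Finset.sum_congr rfl fun I _ => ?_
        rcases I.eq_empty_or_nonempty with rfl | hI
        · simp
        · rw [if_pos hI, if_neg hI.card_ne_zero]
    _ = _ := by
        rw [h, Finset.sum_range_succ', Finset.range_eq_Ico, Finset.sum_Ico_add'
          (fun k => s.card.choose k • if k = 0 then 0 else f k)]
        simp only [if_true, smul_zero, add_zero, zero_add]
        refine Finset.sum_congr (by ext; simp) fun k hk => ?_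
        rw [if_neg (by rw [Finset.mem_Icc] at hk; omega), nsmul_eq_mul]

/-- The distribution of the probability of the slack set, on the tight families of size `k`. -/
noncomputable def tightLaw {Z E : Type*} [Zero E] [MeasurableSpace Z] (A : Set E) (F : Z → E → ℝ)
    (P : Measure Z) (k : ℕ) : Measure ℝ :=
  ((Measure.pi fun _ : Fin k => P).restrict {z | IsTight A F (Set.range z)}).map
    fun z => P.real (slackSet A F (Set.range z))

/-- The samples `z i`, `i ∈ I`, are tight, the probability of their slack set is in `B`, and this
set contains, of the other samples, exactly the `z j`, `j ∈ J`. -/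
def splitEvent {Z E : Type*} [Zero E] [MeasurableSpace Z] (A : Set E) (F : Z → E → ℝ)
    (P : Measure Z) {ι : Type*} (I J : Finset ι) (B : Set ℝ) : Set (ι → Z) :=
  {z | IsTight A F (z '' I) ∧ P.real (slackSet A F (z '' I)) ∈ B ∧
    (∀ j ∈ J, z j ∈ slackSet A F (z '' I)) ∧
    ∀ j, j ∉ I → j ∉ J → z j ∉ slackSet A F (z '' I)}

namespace IsConvexProgram

variable {Z E : Type*} [NormedAddCommGroup E] [NormedSpace ℝ E] {A : Set E} {F : Z → E → ℝ}
  [MeasurableSpace Z] [ProperSpace E] [MeasurableSpace E] [BorelSpace E]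
  [SecondCountableTopology E] {P : Measure Z} [IsProbabilityMeasure P]

instance (k : ℕ) : IsFiniteMeasure (tightLaw A F P k) := by
  unfold tightLaw; infer_instance

lemma measurable_measure_slackSet (hF : IsConvexProgram A F)
    (hm : ∀ w, Measurable fun z => F z w) {ι : Type*} [Finite ι] [Nonempty ι] :
    Measurable fun z : ι → Z => P (slackSet A F (Set.range z)) :=
  measurable_measure_prodMk_left (hF.measurableSet_mem_slackSet hm)

lemma measurableSet_slackSet (hF : IsConvexProgram A F)
    (hm : ∀ w, Measurable fun z => F z w) {ι : Type*} [Finite ι] [Nonempty ι] (z : ι → Z) :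
    MeasurableSet (slackSet A F (Set.range z)) :=
  measurable_prodMk_left (hF.measurableSet_mem_slackSet hm)

lemma tightLaw_compl_Icc (hF : IsConvexProgram A F)
    (hm : ∀ w, Measurable fun z => F z w) {k : ℕ} (hk : 0 < k) :
    tightLaw A F P k (Set.Icc 0 1)ᶜ = 0 := by
  have : Nonempty (Fin k) := ⟨⟨0, hk⟩⟩
  have hv : Measurable fun z : Fin k → Z => P.real (slackSet A F (Set.range z)) :=
    (hF.measurable_measure_slackSet hm).ennreal_toReal
  unfold tightLaw
  rw [Measure.map_apply hv measurableSet_Icc.compl]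
  convert measure_empty (μ := (Measure.pi fun _ : Fin k => P).restrict _)
  ext z
  simp [measureReal_nonneg, measureReal_le_one]

/-- Conditionally on the samples in `I`, the others are independent, so `J` contributes powers of
the slack probability `t` and the remaining indices contribute powers of `1 - t`. -/
lemma measure_split (hF : IsConvexProgram A F) (hm : ∀ w, Measurable fun z => F z w)
    {ι : Type*} [Fintype ι] {I J : Finset ι} (hI : I.Nonempty) (hIJ : Disjoint I J)
    {B : Set ℝ} (hB : MeasurableSet B) :
    MeasurableSet (splitEvent A F P I J B) ∧
    (Measure.pi fun _ : ι => P) (splitEvent A F P I J B) =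
      ∫⁻ t in B, ENNReal.ofReal t ^ J.card *
        ENNReal.ofReal (1 - t) ^ (Fintype.card ι - I.card - J.card) ∂tightLaw A F P I.card := by
  classical
  have hne : Nonempty {i // i ∈ I} := ⟨⟨hI.choose, hI.choose_spec⟩⟩
  have hne' : Nonempty (Fin I.card) := ⟨⟨0, hI.card_pos⟩⟩
  let Λ : Set Z → Set Z := slackSet A F
  let D : Set Z → {i // i ∉ I} → Set Z := fun T j => if j.1 ∈ J then Λ T else (Λ T)ᶜ
  let M : Set (({i // i ∈ I} → Z) × ({i // i ∉ I} → Z)) :=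
    {q | IsTight A F (Set.range q.1) ∧ P.real (Λ (Set.range q.1)) ∈ B ∧
      ∀ j, q.2 j ∈ D (Set.range q.1) j}
  have hT : MeasurableSet {x : {i // i ∈ I} → Z | IsTight A F (Set.range x)} :=
    hF.measurableSet_isTight hm
  have hΛ := hF.measurableSet_mem_slackSet hm (ι := {i // i ∈ I})
  have hv : Measurable fun x : {i // i ∈ I} → Z => P.real (Λ (Set.range x)) :=
    (hF.measurable_measure_slackSet hm).ennreal_toReal
  have hM : MeasurableSet M := by
    refine (measurable_fst hT).inter ((hv.comp measurable_fst hB).inter ?_)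
    change MeasurableSet {q : ({i // i ∈ I} → Z) × ({i // i ∉ I} → Z) |
      ∀ j, q.2 j ∈ D (Set.range q.1) j}
    rw [Set.ofPred_forall]
    refine MeasurableSet.iInter fun j => ?_
    have hΛ' : MeasurableSet {q : ({i // i ∈ I} → Z) × ({i // i ∉ I} → Z) |
        q.2 j ∈ Λ (Set.range q.1)} := by
      have hpair : Measurable fun q : ({i // i ∈ I} → Z) × ({i // i ∉ I} → Z) => (q.1, q.2 j) :=
        measurable_fst.prodMk ((measurable_pi_apply j).comp measurable_snd)
      exact hpair hΛ
    by_cases hj : j.1 ∈ J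
    · simpa only [D, hj, if_true] using hΛ'
    · simp only [D, hj, if_false]
      exact hΛ'.compl
  have hpre : splitEvent A F P I J B =
      (MeasurableEquiv.piEquivPiSubtypeProd (fun _ : ι => Z) (fun i => i ∈ I)) ⁻¹' M := by
    ext z
    have hr : Set.range ((MeasurableEquiv.piEquivPiSubtypeProd (fun _ : ι => Z)
        (fun i => i ∈ I)) z).1 = z '' I := by
      ext y
      simp [MeasurableEquiv.piEquivPiSubtypeProd, Equiv.piEquivPiSubtypeProd]
    simp only [splitEvent, Set.mem_ofPred_eq, Set.mem_preimage, M, hr]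
    refine and_congr_right fun _ => and_congr_right fun _ => ?_
    have hz : ∀ j : {i // i ∉ I}, ((MeasurableEquiv.piEquivPiSubtypeProd (fun _ : ι => Z)
        (fun i => i ∈ I)) z).2 j = z j := fun j => rfl
    simp only [hz]
    constructor
    · rintro ⟨h1, h2⟩ ⟨j, hj⟩
      by_cases hjJ : j ∈ J
      · simpa only [D, hjJ, if_true] using h1 j hjJ
      · simp only [D, hjJ, if_false]
        exact h2 j hj hjJ
    · intro h
      refine ⟨fun j hj => ?_, fun j hj hjJ => ?_⟩
      · have := h ⟨j, fun hjI => Finset.disjoint_left.1 hIJ hjI hj⟩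
        simpa only [D, hj, if_true] using this
      · have := h ⟨j, hj⟩
        simp only [D, hjJ, if_false] at this
        exact this
  refine ⟨hpre ▸ MeasurableEquiv.measurable _ hM, ?_⟩
  rw [hpre, (measurePreserving_piEquivPiSubtypeProd (fun _ : ι => P)
    (fun i => i ∈ I)).measure_preimage hM.nullMeasurableSet, Measure.prod_apply hM]
  let φ : ℝ → ℝ≥0∞ := fun t => ENNReal.ofReal t ^ J.card *
        ENNReal.ofReal (1 - t) ^ (Fintype.card ι - I.card - J.card)
  let g : Set Z → ℝ≥0∞ := fun T => if IsTight A F T ∧ P.real (Λ T) ∈ B then φ (P.real (Λ T)) else 0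
  have hcardJ : (Finset.univ.filter fun j : {i // i ∉ I} => j.1 ∈ J).card = J.card := by
    refine Finset.card_bij (fun j _ => j.1) (fun j hj => (Finset.mem_filter.1 hj).2)
      (fun a _ b _ h => Subtype.ext h) fun j hj => ?_
    exact ⟨⟨j, fun hjI => Finset.disjoint_left.1 hIJ hjI hj⟩, by simpa using hj, rfl⟩
  have hcard : Fintype.card {i // i ∉ I} = Fintype.card ι - I.card := by
    rw [Fintype.card_subtype_compl, Fintype.card_coe]
  have hsec : ∀ x : {i // i ∈ I} → Z,
      (Measure.pi fun _ : {i // i ∉ I} => P) (Prod.mk x ⁻¹' M) = g (Set.range x) := by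
    intro x
    by_cases hx : IsTight A F (Set.range x) ∧ P.real (Λ (Set.range x)) ∈ B
    · have : Prod.mk x ⁻¹' M = Set.univ.pi fun j => D (Set.range x) j := by
        ext y
        simp [M, hx.1, hx.2]
      rw [this, Measure.pi_pi]
      simp only [g, if_pos hx, φ]
      have hD : ∀ j, P (D (Set.range x) j) = if j.1 ∈ J then
          ENNReal.ofReal (P.real (Λ (Set.range x))) else
          ENNReal.ofReal (1 - P.real (Λ (Set.range x))) := by
        intro j
        simp only [D]
        split_ifs
        · rw [ofReal_measureReal]
        · rw [← probReal_compl_eq_one_sub (hF.measurableSet_slackSet hm x), ofReal_measureReal]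
      simp only [hD]
      rw [Finset.prod_ite, Finset.prod_const, Finset.prod_const, hcardJ]
      congr 2
      rw [Finset.filter_not, Finset.card_sdiff_of_subset (Finset.filter_subset _ _), hcardJ,
        Finset.card_univ, hcard]
    · have : Prod.mk x ⁻¹' M = ∅ := by
        ext y
        simp only [M, Set.mem_preimage, Set.mem_ofPred_eq, Set.mem_empty_iff_false, iff_false]
        exact fun h => hx ⟨h.1, h.2.1⟩
      simp [this, g, hx]
  rw [lintegral_congr hsec]
  refine (@lintegral_pi_range_congr _ _ P _ {i // i ∈ I} _ (Subtype.fintype _) _ I.equivFin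
    g).trans ?_
  have hv' : Measurable fun x : Fin I.card → Z => P.real (Λ (Set.range x)) :=
    (hF.measurable_measure_slackSet hm).ennreal_toReal
  have hφ : Measurable φ := by fun_prop
  unfold tightLaw
  rw [Measure.restrict_map hv' hB, lintegral_map hφ hv', Measure.restrict_restrict (hv' hB),
    ← lintegral_indicator ((hv' hB).inter (hF.measurableSet_isTight hm))]
  refine lintegral_congr fun x => ?_
  simp only [g, Set.indicator_apply, Set.mem_inter_iff, Set.mem_preimage, Set.mem_ofPred_eq]
  by_cases h1 : IsTight A F (Set.range x) <;> by_cases h2 : P.real (Λ (Set.range x)) ∈ B <;>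
    simp [h1, h2, Λ, φ]

/-- In a tight family this large some member can be deleted without changing the minimax pair, yet
it attains the minimax value of the others at their minimizer. As it is independent of the others,
this has probability zero. -/
lemma tightLaw_eq_zero [FiniteDimensional ℝ E] (hF : IsConvexProgram A F)
    (hm : ∀ w, Measurable fun z => F z w) (hnull : ∀ w r, P {y | F y w = r} = 0) {k : ℕ}
    (hk : Module.finrank ℝ E + 1 < k) : tightLaw A F P k = 0 := by
  classical
  have hzero : (Measure.pi fun _ : Fin k => P) {z | IsTight A F (Set.range z)} = 0 := by
    obtain ⟨n, rfl⟩ : ∃ n, k = n + 1 := ⟨k - 1, by omega⟩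
    have hn : Nonempty (Fin n) := ⟨⟨0, by omega⟩⟩
    let N : Set (Z × (Fin n → Z)) := {q | F q.1 (minimax A F (Set.range q.2)).1 =
      (minimax A F (Set.range q.2)).2}
    have hN : MeasurableSet N := measurableSet_eq_fun
      ((hF.measurable_eval_minimax hm).comp measurable_swap)
      ((hF.measurable_minimax_snd hm).comp measurable_snd)
    have hN0 : (P.prod (Measure.pi fun _ : Fin n => P)) N = 0 := by
      rw [Measure.prod_apply_symm hN, lintegral_eq_zero_iff (measurable_measure_prodMk_right hN)]
      exact Filter.Eventually.of_forall fun x =>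
        hnull (minimax A F (Set.range x)).1 (minimax A F (Set.range x)).2
    refine measure_mono_null (t := ⋃ i : Fin (n + 1),
      (MeasurableEquiv.piFinSuccAbove (fun _ => Z) i) ⁻¹' N) ?_ ?_
    · intro z hz
      have hp := hF.isMinimax_minimax (Set.finite_range z) (Set.range_nonempty z)
      obtain ⟨i, -, hi⟩ := hF.exists_minimax_erase z (I := Finset.univ) (by simpa using hk)
        (p := minimax A F (Set.range z)) (by simpa using hp)
      refine Set.mem_iUnion.2 ⟨i, ?_⟩
      have hr : Set.range ((MeasurableEquiv.piFinSuccAbove (fun _ => Z) i) z).2 =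
          z '' (Finset.univ.erase i : Finset (Fin (n + 1))) := by
        change Set.range (fun j => z (i.succAbove j)) = _
        rw [show (fun j => z (i.succAbove j)) = z ∘ i.succAbove from rfl, Set.range_comp,
          Fin.range_succAbove]
        congr 1
        ext j; simp
      rw [← hr] at hi
      have heq := hF.minimax_eq (Set.finite_range _) (Set.range_nonempty _) hi
      change F (z i) _ = _
      rw [heq]
      exact hz _ ⟨i, rfl⟩
    · rw [measure_iUnion_null_iff]
      intro i
      exact ((measurePreserving_piFinSuccAbove (fun _ : Fin (n + 1) => P) i).measure_preimage
        hN.nullMeasurableSet).trans hN0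
  unfold tightLaw
  rw [Measure.restrict_eq_zero.2 hzero, Measure.map_zero]

/-- The unique tight subfamily that leaves the other members slack partitions the space of `m`
samples. These are the moment identities that constrain the laws. -/
lemma sum_lintegral_tightLaw (hF : IsConvexProgram A F) (hm : ∀ w, Measurable fun z => F z w)
    {m : ℕ} (hm1 : 1 ≤ m) :
    ∑ k ∈ Finset.Icc 1 m, (m.choose k : ℝ≥0∞) *
      ∫⁻ t, ENNReal.ofReal t ^ (m - k) ∂tightLaw A F P k = 1 := by
  classical
  let N : Finset (Finset (Fin m)) := Finset.univ.filter Finset.Nonempty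
  let X : Finset (Fin m) → Set (Fin m → Z) := fun I => splitEvent A F P I Iᶜ Set.univ
  let f : ℕ → ℝ≥0∞ := fun k => ∫⁻ t, ENNReal.ofReal t ^ (m - k) ∂tightLaw A F P k
  have hX : ∀ I ∈ N, MeasurableSet (X I) ∧ (Measure.pi fun _ : Fin m => P) (X I) = f I.card := by
    intro I hI
    obtain ⟨h1, h2⟩ := hF.measure_split hm (P := P) (J := Iᶜ) (Finset.mem_filter.1 hI).2
      disjoint_compl_right MeasurableSet.univ
    refine ⟨h1, h2.trans ?_⟩
    simp [f, Finset.card_compl]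
  have huniv : (⋃ I ∈ N, X I) = Set.univ := by
    refine Set.eq_univ_of_forall fun z => ?_
    obtain ⟨I, ⟨-, hI, ht, hs⟩, -⟩ := hF.existsUnique_tight z (R := (Finset.univ : Finset (Fin m)))
      ⟨⟨0, hm1⟩, Finset.mem_univ _⟩
    simp only [Set.mem_iUnion]
    refine ⟨I, by simpa [N] using hI, ht, Set.mem_univ _, fun j hj => ?_, fun j hj hj' => ?_⟩
    · exact hs j (Finset.mem_univ _) (Finset.mem_compl.1 hj)
    · exact absurd (Finset.mem_compl.2 hj) hj'
  have hdisj : (N : Set (Finset (Fin m))).PairwiseDisjoint X := by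
    intro I hI J hJ hIJ
    refine Set.disjoint_left.2 fun z hz hz' => hIJ ?_
    have hu := hF.existsUnique_tight z (R := (Finset.univ : Finset (Fin m)))
      ⟨⟨0, hm1⟩, Finset.mem_univ _⟩
    exact hu.unique
      ⟨Finset.subset_univ _, (Finset.mem_filter.1 hI).2, hz.1,
        fun j _ hj => hz.2.2.1 j (Finset.mem_compl.2 hj)⟩
      ⟨Finset.subset_univ _, (Finset.mem_filter.1 hJ).2, hz'.1,
        fun j _ hj => hz'.2.2.1 j (Finset.mem_compl.2 hj)⟩
  have h1 : (Measure.pi fun _ : Fin m => P) (⋃ I ∈ N, X I) = ∑ I ∈ N, f I.card := by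
    rw [measure_biUnion_finset hdisj fun I hI => (hX I hI).1]
    exact Finset.sum_congr rfl fun I hI => (hX I hI).2
  rw [huniv, measure_univ] at h1
  have h2 := sum_nonempty_card f (Finset.univ : Finset (Fin m))
  rw [Finset.powerset_univ, Finset.card_univ, Fintype.card_fin] at h2
  exact h2.symm.trans h1.symm

/-- A union bound over `Q` and over the tight subfamily `I` of the kept samples: the other kept
samples are in its slack set and the `q` removed ones are not. -/
lemma measure_exists_removed_le (hF : IsConvexProgram A F)
    (hm : ∀ w, Measurable fun z => F z w) {K q : ℕ} (hq : q < K) (a : ℝ) :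
    (Measure.pi fun _ : Fin K => P) {z | ∃ Q : Finset (Fin K), Q.card = q ∧
        (∀ j ∈ Q, z j ∉ slackSet A F (z '' (Qᶜ : Finset (Fin K)))) ∧
        P.real (slackSet A F (z '' (Qᶜ : Finset (Fin K)))) < a} ≤
      (K.choose q : ℝ≥0∞) * ∑ k ∈ Finset.Icc 1 (K - q), ((K - q).choose k : ℝ≥0∞) *
        ∫⁻ t in Set.Iio a, ENNReal.ofReal t ^ (K - q - k) * ENNReal.ofReal (1 - t) ^ q
          ∂tightLaw A F P k := by
  classical
  let f : ℕ → ℝ≥0∞ := fun k => ∫⁻ t in Set.Iio a,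
    ENNReal.ofReal t ^ (K - q - k) * ENNReal.ofReal (1 - t) ^ q ∂tightLaw A F P k
  let N : Finset (Fin K) → Finset (Finset (Fin K)) := fun Q => Qᶜ.powerset.filter Finset.Nonempty
  have hcard : ∀ Q ∈ Finset.powersetCard q (Finset.univ : Finset (Fin K)), Qᶜ.card = K - q := by
    intro Q hQ
    rw [Finset.card_compl, (Finset.mem_powersetCard.1 hQ).2, Fintype.card_fin]
  calc _ ≤ (Measure.pi fun _ : Fin K => P)
        (⋃ Q ∈ Finset.powersetCard q (Finset.univ : Finset (Fin K)), ⋃ I ∈ N Q,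
          splitEvent A F P I (Qᶜ \ I) (Set.Iio a)) := by
        refine measure_mono ?_
        rintro z ⟨Q, hQ, hviol, hlt⟩
        have hQ' := Finset.mem_powersetCard.2 ⟨Finset.subset_univ Q, hQ⟩
        have hne : (Qᶜ).Nonempty := by rw [← Finset.card_pos, hcard Q hQ']; omega
        obtain ⟨I, ⟨hIQ, hI, ht, hs⟩, -⟩ := hF.existsUnique_tight z hne
        have heq := hF.minimax_eq_of_isTight z hI hIQ ht hs
        have heq' : slackSet A F (z '' (Qᶜ : Finset (Fin K))) = slackSet A F (z '' I) := by
          unfold slackSet; rw [heq]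
        rw [heq'] at hlt
        refine Set.mem_biUnion hQ' (Set.mem_biUnion (x := I) (by simp [N, hIQ, hI]) ?_)
        refine ⟨ht, hlt, fun j hj => ?_, fun j hj hj' => ?_⟩
        · exact hs j (Finset.mem_sdiff.1 hj).1 (Finset.mem_sdiff.1 hj).2
        · rw [← heq']
          refine hviol j ?_
          by_contra hjQ
          exact hj' (Finset.mem_sdiff.2 ⟨Finset.mem_compl.2 hjQ, hj⟩)
    _ ≤ ∑ Q ∈ Finset.powersetCard q (Finset.univ : Finset (Fin K)), ∑ I ∈ N Q, f I.card := by
        refine (measure_biUnion_finset_le _ _).trans (Finset.sum_le_sum fun Q hQ => ?_)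
        refine (measure_biUnion_finset_le _ _).trans (Finset.sum_le_sum fun I hI => ?_)
        obtain ⟨hIQ, hne⟩ := Finset.mem_filter.1 hI
        rw [Finset.mem_powerset] at hIQ
        rw [(hF.measure_split hm hne Finset.disjoint_sdiff measurableSet_Iio).2,
          Finset.card_sdiff_of_subset hIQ, hcard Q hQ, Fintype.card_fin]
        have h1 := Finset.card_le_card hIQ
        rw [hcard Q hQ] at h1
        have h2 : K - I.card - (K - q - I.card) = q := by omega
        rw [h2]
    _ = _ := by
        rw [Finset.sum_congr rfl fun Q hQ => by
          rw [sum_nonempty_card f Qᶜ, hcard Q hQ], Finset.sum_const, Finset.card_powersetCard,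
          Finset.card_univ, Fintype.card_fin, nsmul_eq_mul]

end IsConvexProgram

/-! ### Repeated antiderivatives of polynomials. -/

/-- The antiderivative of a polynomial that vanishes at zero. -/
noncomputable def Polynomial.antideriv : Polynomial ℝ →ₗ[ℝ] Polynomial ℝ :=
  Polynomial.lsum fun n => (Polynomial.monomial (n + 1)).comp
    (LinearMap.mulLeft ℝ ((n + 1 : ℝ)⁻¹))

namespace Polynomial

lemma antideriv_monomial (n : ℕ) (r : ℝ) :
    antideriv (monomial n r) = monomial (n + 1) ((n + 1 : ℝ)⁻¹ * r) := by
  simp [antideriv, lsum_apply, sum_monomial_index]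

lemma derivative_antideriv (p : ℝ[X]) : derivative (antideriv p) = p := by
  induction p using Polynomial.induction_on' with
  | add p q hp hq => rw [map_add, derivative_add, hp, hq]
  | monomial n r =>
    rw [antideriv_monomial, derivative_monomial]
    congr 1
    push_cast
    have : (n : ℝ) + 1 ≠ 0 := by positivity
    field_simp

lemma coeff_zero_antideriv (p : ℝ[X]) : (antideriv p).coeff 0 = 0 := by
  induction p using Polynomial.induction_on' with
  | add p q hp hq => rw [map_add, coeff_add, hp, hq, add_zero]
  | monomial n r => rw [antideriv_monomial, coeff_monomial]; simp

lemma antideriv_derivative {p : ℝ[X]} (hp : p.coeff 0 = 0) : antideriv (derivative p) = p := by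
  have h1 : derivative (antideriv (derivative p) - p) = 0 := by
    rw [derivative_sub, derivative_antideriv, sub_self]
  have h2 := eq_C_of_derivative_eq_zero h1
  rw [coeff_sub, coeff_zero_antideriv, hp, sub_zero, C_0, sub_eq_zero] at h2
  exact h2

lemma hasDerivAt_antideriv (p : ℝ[X]) (x : ℝ) :
    HasDerivAt (fun y => (antideriv p).eval y) (p.eval x) x := by
  have := (antideriv p).hasDerivAt x
  rwa [derivative_antideriv] at this

lemma eval_zero_antideriv (p : ℝ[X]) : (antideriv p).eval 0 = 0 := by
  rw [← coeff_zero_eq_eval_zero, coeff_zero_antideriv]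

lemma eval_antideriv (p : ℝ[X]) (x : ℝ) : (antideriv p).eval x = ∫ t in (0 : ℝ)..x, p.eval t := by
  rw [intervalIntegral.integral_eq_sub_of_hasDerivAt (fun y _ => hasDerivAt_antideriv p y)
    (p.continuous.intervalIntegrable _ _), eval_zero_antideriv, sub_zero]

lemma eval_iterate_antideriv_mono {p q : ℝ[X]} {b : ℝ} (h : ∀ t ∈ Set.Icc 0 b, p.eval t ≤ q.eval t)
    (j : ℕ) : ∀ t ∈ Set.Icc 0 b, (antideriv^[j] p).eval t ≤ (antideriv^[j] q).eval t := by
  induction j with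
  | zero => simpa using h
  | succ j ih =>
    intro t ht
    rw [Function.iterate_succ_apply', Function.iterate_succ_apply', eval_antideriv, eval_antideriv]
    exact intervalIntegral.integral_mono_on ht.1 (Polynomial.continuous _ |>.intervalIntegrable _ _)
      (Polynomial.continuous _ |>.intervalIntegrable _ _)
      fun s hs => ih s ⟨hs.1, hs.2.trans ht.2⟩

lemma derivative_iterate_antideriv (p : ℝ[X]) {k d : ℕ} (hk : k ≤ d) :
    derivative^[k] (antideriv^[d] p) = antideriv^[d - k] p := by
  induction k with
  | zero => rfl
  | succ k ih =>
    rw [Function.iterate_succ_apply', ih (by omega), show d - k = (d - (k + 1)) + 1 by omega,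
      Function.iterate_succ_apply', derivative_antideriv]

/-- No constant of integration is lost, because the derivatives of `X ^ N` of order below `N` vanish
at zero. -/
lemma antideriv_iterate_derivative_X_pow {N d j : ℕ} (hd : d ≤ N) (hj : j ≤ d) :
    antideriv^[j] (derivative^[d] (X ^ N : ℝ[X])) = derivative^[d - j] (X ^ N : ℝ[X]) := by
  induction j with
  | zero => rfl
  | succ j ih =>
    rw [Function.iterate_succ_apply', ih (by omega), show d - j = (d - (j + 1)) + 1 by omega,
      Function.iterate_succ_apply', antideriv_derivative]
    rw [coeff_zero_eq_eval_zero, iterate_derivative_X_pow_eq_C_mul]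
    have : N - (d - (j + 1)) ≠ 0 := by omega
    simp [this]

/-- Repeated antiderivatives, as in Taylor's formula with integral remainder. -/
lemma eval_one_iterate_antideriv (p : ℝ[X]) (d : ℕ) :
    (antideriv^[d + 1] p).eval 1 =
      ∫ t in (0 : ℝ)..1, (1 - t) ^ d / (d.factorial : ℝ) * p.eval t := by
  induction d generalizing p with
  | zero => simp [eval_antideriv]
  | succ d ih =>
    rw [Function.iterate_succ_apply, ih]
    have hder : ∀ t : ℝ, HasDerivAt
        (fun t => (1 - t) ^ (d + 1) / ((d + 1).factorial : ℝ) * (antideriv p).eval t)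
        ((1 - t) ^ (d + 1) / ((d + 1).factorial : ℝ) * p.eval t -
          (1 - t) ^ d / (d.factorial : ℝ) * (antideriv p).eval t) t := by
      intro t
      have h1 : HasDerivAt (fun t : ℝ => (1 - t) ^ (d + 1) / ((d + 1).factorial : ℝ))
          (-((1 - t) ^ d / (d.factorial : ℝ))) t := by
        have h := ((((hasDerivAt_id t).const_sub 1).pow (d + 1)).div_const
          ((d + 1).factorial : ℝ))
        refine h.congr_deriv ?_
        rw [Nat.factorial_succ]
        push_cast
        have : (d : ℝ) + 1 ≠ 0 := by positivity
        have h2 : (d.factorial : ℝ) ≠ 0 := by positivity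
        simp only [id]
        field_simp
      refine (h1.mul (hasDerivAt_antideriv p t)).congr_deriv ?_
      ring
    have hc : ∀ q : ℝ[X], ∀ n : ℕ,
        Continuous fun t : ℝ => (1 - t) ^ n / (n.factorial : ℝ) * q.eval t := fun q n =>
      (by fun_prop : Continuous fun t : ℝ => (1 - t) ^ n / (n.factorial : ℝ)).mul q.continuous
    have h := intervalIntegral.integral_eq_sub_of_hasDerivAt (a := 0) (b := 1)
      (fun t _ => hder t) (((hc _ _).sub (hc _ _)).intervalIntegrable _ _)
    rw [intervalIntegral.integral_sub ((hc _ _).intervalIntegrable _ _)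
      ((hc _ _).intervalIntegrable _ _), eval_zero_antideriv] at h
    simp only [sub_self, ne_eq, Nat.add_eq_zero_iff, one_ne_zero, and_false, not_false_eq_true,
      zero_pow, zero_div, zero_mul, mul_zero] at h
    linarith

end Polynomial

/-! ### Incomplete beta integrals and polynomial majorants. -/

/-- The derivatives of the summands telescope. For `m = 0` the truncated exponent `m - 1` is
harmless because of the factor `m`. -/
lemma hasDerivAt_sum_choose {K : ℕ} (m : ℕ) (hm : m ≤ K) (x : ℝ) :
    HasDerivAt (fun a : ℝ => ∑ i ∈ Finset.range m, (K.choose i : ℝ) * a ^ (K - i) * (1 - a) ^ i)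
      ((m : ℝ) * K.choose m * x ^ (K - m) * (1 - x) ^ (m - 1)) x := by
  induction m with
  | zero => simpa using hasDerivAt_const x (0 : ℝ)
  | succ m ih =>
    simp only [Finset.sum_range_succ]
    have h1 : HasDerivAt (fun a : ℝ => (K.choose m : ℝ) * a ^ (K - m) * (1 - a) ^ m)
        ((K.choose m : ℝ) * (((K - m : ℕ) : ℝ) * x ^ (K - m - 1)) * (1 - x) ^ m +
          (K.choose m : ℝ) * x ^ (K - m) * (-((m : ℝ) * (1 - x) ^ (m - 1)))) x := by
      have h2 : HasDerivAt (fun a : ℝ => (1 - a) ^ m) (-((m : ℝ) * (1 - x) ^ (m - 1))) x :=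
        (((hasDerivAt_id x).const_sub 1).pow m).congr_deriv (by simp)
      exact ((hasDerivAt_pow (K - m) x).const_mul _).mul h2
    refine ((ih (by omega)).add h1).congr_deriv ?_
    have hch : (K.choose (m + 1) : ℝ) * (m + 1) = K.choose m * ((K - m : ℕ) : ℝ) := by
      exact_mod_cast Nat.choose_succ_right_eq K m
    rw [show K - m - 1 = K - (m + 1) by omega, Nat.add_sub_cancel]
    push_cast
    linear_combination (-(x ^ (K - (m + 1)) * (1 - x) ^ m)) * hch

/-- The incomplete beta integral as a binomial tail. -/
lemma integral_pow_mul_one_sub_pow {K m : ℕ} (hm : m ≤ K) (a : ℝ) :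
    ∫ t in (0 : ℝ)..a, (m : ℝ) * K.choose m * t ^ (K - m) * (1 - t) ^ (m - 1) =
      ∑ i ∈ Finset.range m, (K.choose i : ℝ) * a ^ (K - i) * (1 - a) ^ i := by
  rw [intervalIntegral.integral_eq_sub_of_hasDerivAt (fun x _ => hasDerivAt_sum_choose m hm x)
    ((by fun_prop : Continuous _).intervalIntegrable _ _)]
  have : ∑ i ∈ Finset.range m, (K.choose i : ℝ) * 0 ^ (K - i) * (1 - 0) ^ i = 0 := by
    refine Finset.sum_eq_zero fun i hi => ?_
    have := Finset.mem_range.1 hi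
    rw [zero_pow (by omega)]
    simp
  rw [this, sub_zero]

/-- A continuous function on `[0, 1]` that vanishes beyond `a` (up to a jump at `a`) has polynomial
majorants on `[0, 1]` with almost the same weighted integral. -/
lemma exists_polynomial_majorant {g ω : ℝ → ℝ} (hg : Continuous g) (hω : Continuous ω) {a : ℝ}
    (ha : a ∈ Set.Icc (0 : ℝ) 1) (hg0 : ∀ t ∈ Set.Icc (0 : ℝ) 1, 0 ≤ g t)
    (hω0 : ∀ t ∈ Set.Icc (0 : ℝ) 1, 0 ≤ ω t) {ε : ℝ} (hε : 0 < ε) :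
    ∃ r : Polynomial ℝ, (∀ t ∈ Set.Icc (0 : ℝ) 1, 0 ≤ r.eval t) ∧
      (∀ t ∈ Set.Icc (0 : ℝ) a, g t ≤ r.eval t) ∧
      ∫ t in (0 : ℝ)..1, ω t * r.eval t ≤ (∫ t in (0 : ℝ)..a, ω t * g t) + ε := by
  obtain ⟨M, hM⟩ := (isCompact_Icc (a := (0 : ℝ)) (b := 1)).bddAbove_image
    (hω.mul hg).continuousOn
  obtain ⟨M', hM'⟩ := (isCompact_Icc (a := (0 : ℝ)) (b := 1)).bddAbove_image hω.continuousOn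
  have hM1 : ∀ t ∈ Set.Icc (0 : ℝ) 1, ω t * g t ≤ M := fun t ht => hM ⟨t, ht, rfl⟩
  have hM2 : ∀ t ∈ Set.Icc (0 : ℝ) 1, ω t ≤ M' := fun t ht => hM' ⟨t, ht, rfl⟩
  have h0 : (0 : ℝ) ∈ Set.Icc (0 : ℝ) 1 := by simp
  have hMn : 0 ≤ M := (mul_nonneg (hω0 0 h0) (hg0 0 h0)).trans (hM1 0 h0)
  have hMn' : 0 ≤ M' := (hω0 0 h0).trans (hM2 0 h0)
  -- The tail of the cutoff beyond `a` costs at most `M * η` and the approximation error at most `2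
  -- * M' * η`; the extra `1` keeps the denominator positive.
  set η := ε / (M + 2 * M' + 1) with hη
  have hηpos : 0 < η := by positivity
  have hηε : M * η + 2 * M' * η ≤ ε := by
    rw [← add_mul, hη, mul_div_assoc', div_le_iff₀ (by positivity)]
    nlinarith
  -- A continuous cutoff that is one up to `a` and has integral at most `η` beyond it. By
  -- Weierstrass, `g * χ` is approximated within `η`, and adding `η` turns the approximation into a
  -- majorant.
  let χ : ℝ → ℝ := fun t => min 1 (Real.exp (-(t - a) / η))
  have hχ : Continuous χ := by fun_prop
  have hχ0 : ∀ t, 0 ≤ χ t := fun t => le_min zero_le_one (Real.exp_pos _).le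
  have hχ1 : ∀ t ≤ a, χ t = 1 := fun t ht => by
    refine min_eq_left (Real.one_le_exp ?_)
    exact div_nonneg (by linarith) hηpos.le
  obtain ⟨r₀, hr₀⟩ := exists_polynomial_near_of_continuousOn 0 1 (fun t => g t * χ t)
    (hg.mul hχ).continuousOn η hηpos
  have hr : ∀ t ∈ Set.Icc (0 : ℝ) 1, g t * χ t ≤ (r₀ + Polynomial.C η).eval t ∧
      (r₀ + Polynomial.C η).eval t ≤ g t * χ t + 2 * η := by
    intro t ht
    have := abs_lt.1 (hr₀ t ht)
    rw [Polynomial.eval_add, Polynomial.eval_C]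
    constructor <;> linarith [this.1, this.2]
  refine ⟨r₀ + Polynomial.C η, fun t ht => (mul_nonneg (hg0 t ht) (hχ0 t)).trans (hr t ht).1,
    fun t ht => ?_, ?_⟩
  · have := (hr t ⟨ht.1, ht.2.trans ha.2⟩).1
    rwa [hχ1 t ht.2, mul_one] at this
  · have hc1 : Continuous fun t => ω t * (r₀ + Polynomial.C η).eval t :=
      hω.mul (Polynomial.continuous _)
    have hc2 : Continuous fun t => ω t * (g t * χ t) := hω.mul (hg.mul hχ)
    have hstep : ∫ t in (0 : ℝ)..1, ω t * (r₀ + Polynomial.C η).eval t ≤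
        ∫ t in (0 : ℝ)..1, (ω t * (g t * χ t) + 2 * M' * η) := by
      refine intervalIntegral.integral_mono_on zero_le_one (hc1.intervalIntegrable _ _)
        ((hc2.add continuous_const).intervalIntegrable _ _) fun t ht => ?_
      have h1 := mul_le_mul_of_nonneg_left (hr t ht).2 (hω0 t ht)
      have h2 := mul_le_mul_of_nonneg_right (hM2 t ht) hηpos.le
      nlinarith
    rw [intervalIntegral.integral_add (hc2.intervalIntegrable _ _)
      (continuous_const.intervalIntegrable _ _), intervalIntegral.integral_const,
      ← intervalIntegral.integral_add_adjacent_intervals (b := a) (hc2.intervalIntegrable _ _)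
        (hc2.intervalIntegrable _ _)] at hstep
    have hleft : ∫ t in (0 : ℝ)..a, ω t * (g t * χ t) = ∫ t in (0 : ℝ)..a, ω t * g t := by
      refine intervalIntegral.integral_congr fun t ht => ?_
      rw [Set.uIcc_of_le ha.1] at ht
      simp only [hχ1 t ht.2, mul_one]
    have hexp : ∀ t : ℝ, HasDerivAt (fun t => -(M * η) * Real.exp (-(t - a) / η))
        (M * Real.exp (-(t - a) / η)) t := by
      intro t
      have h : HasDerivAt (fun t => -(t - a) / η) (-1 / η) t :=
        ((hasDerivAt_id t).sub_const a).neg.div_const η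
      refine (h.exp.const_mul (-(M * η))).congr_deriv ?_
      field_simp
    have hright : ∫ t in a..1, ω t * (g t * χ t) ≤ M * η := by
      calc _ ≤ ∫ t in a..1, M * Real.exp (-(t - a) / η) := by
            refine intervalIntegral.integral_mono_on ha.2 (hc2.intervalIntegrable _ _)
              ((by fun_prop : Continuous _).intervalIntegrable _ _) fun t ht => ?_
            have ht' : t ∈ Set.Icc (0 : ℝ) 1 := ⟨ha.1.trans ht.1, ht.2⟩
            rw [← mul_assoc]
            exact mul_le_mul (hM1 t ht') (min_le_right _ _) (hχ0 t) hMn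
        _ = -(M * η) * Real.exp (-(1 - a) / η) + M * η := by
            rw [intervalIntegral.integral_eq_sub_of_hasDerivAt (fun t _ => hexp t)
              ((by fun_prop : Continuous _).intervalIntegrable _ _)]
            simp
        _ ≤ M * η := by
            have : 0 ≤ M * η * Real.exp (-(1 - a) / η) := by positivity
            linarith
    rw [hleft] at hstep
    simp only [sub_zero, one_smul] at hstep
    linarith

/-! ### The moment problem and its dual bound. -/

lemma Continuous.integrable_of_compl_Icc {μ : Measure ℝ} [IsFiniteMeasure μ]
    (hμ : μ (Set.Icc 0 1)ᶜ = 0) {f : ℝ → ℝ} (hf : Continuous f) : Integrable f μ := by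
  obtain ⟨M, hM⟩ := (isCompact_Icc (a := (0 : ℝ)) (b := 1)).exists_bound_of_continuousOn
    hf.continuousOn
  refine Integrable.of_bound hf.aestronglyMeasurable M ?_
  have : ∀ᵐ t ∂μ, t ∈ Set.Icc (0 : ℝ) 1 := hμ
  filter_upwards [this] with t ht using hM t ht

/-- For `p = X ^ m` this is the `m`-th moment identity; the rest is linearity. There is no identity
for `m = 0`, hence the condition on the constant coefficient. -/
lemma sum_integral_hasseDeriv {d : ℕ} {μ : ℕ → Measure ℝ} [∀ k, IsFiniteMeasure (μ k)]
    (hμ : ∀ k ∈ Finset.Icc 1 d, μ k (Set.Icc 0 1)ᶜ = 0)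
    (h : ∀ m : ℕ, 1 ≤ m →
      ∑ k ∈ Finset.Icc 1 d, (m.choose k : ℝ) * ∫ t, t ^ (m - k) ∂μ k = 1)
    {p : Polynomial ℝ} (hp : p.coeff 0 = 0) :
    ∑ k ∈ Finset.Icc 1 d, ∫ t, (Polynomial.hasseDeriv k p).eval t ∂μ k = p.eval 1 := by
  have hk : ∀ k ∈ Finset.Icc 1 d, ∫ t, (Polynomial.hasseDeriv k p).eval t ∂μ k =
      ∑ m ∈ p.support, p.coeff m * ((m.choose k : ℝ) * ∫ t, t ^ (m - k) ∂μ k) := by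
    intro k hk
    have : ∀ t, (Polynomial.hasseDeriv k p).eval t =
        ∑ m ∈ p.support, p.coeff m * ((m.choose k : ℝ) * t ^ (m - k)) := by
      intro t
      rw [Polynomial.hasseDeriv_apply, Polynomial.sum, Polynomial.eval_finsetSum]
      refine Finset.sum_congr rfl fun m _ => ?_
      rw [Polynomial.eval_monomial]
      ring
    simp only [this]
    rw [integral_finsetSum _ fun m _ => (by fun_prop : Continuous _).integrable_of_compl_Icc
      (hμ k hk)]
    simp only [integral_const_mul]
  rw [Finset.sum_congr rfl hk, Finset.sum_comm, Polynomial.eval_eq_sum, Polynomial.sum]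
  refine Finset.sum_congr rfl fun m hm => ?_
  rw [← Finset.mul_sum, h m, one_pow]
  rcases Nat.eq_zero_or_pos m with rfl | hm'
  · exact absurd hp (Polynomial.mem_support_iff.1 hm)
  · exact hm'

/-- Matches the constant of the Taylor remainder integral with that of the incomplete beta integral.
-/
lemma choose_mul_descFactorial {d N q : ℕ} (hd : 1 ≤ d) (hN : d ≤ N) :
    (N + q).choose q * N.descFactorial d =
      (q + d - 1).choose q * ((q + d) * (N + q).choose (q + d)) * (d - 1).factorial := by
  obtain ⟨e, rfl⟩ := Nat.exists_eq_add_of_le' hd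
  have hA : (N + q).choose q * q.factorial * N.factorial = (N + q).factorial := by
    have := Nat.choose_mul_factorial_mul_factorial (Nat.le_add_left q N)
    rwa [Nat.add_sub_cancel] at this
  have hB := Nat.factorial_mul_descFactorial hN
  have hC : (q + e).choose q * q.factorial * e.factorial = (q + e).factorial := by
    have := Nat.choose_mul_factorial_mul_factorial (Nat.le_add_right q e)
    rwa [Nat.add_sub_cancel_left] at this
  have hE : (N + q).choose (q + (e + 1)) * (q + (e + 1)).factorial * (N - (e + 1)).factorial =
      (N + q).factorial := by
    have := Nat.choose_mul_factorial_mul_factorial (show q + (e + 1) ≤ N + q by omega)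
    rwa [show N + q - (q + (e + 1)) = N - (e + 1) by omega] at this
  have hF : (q + (e + 1)).factorial = (q + (e + 1)) * (q + e).factorial := Nat.factorial_succ _
  have hpos : 0 < q.factorial * N.factorial * (N - (e + 1)).factorial := by positivity
  refine Nat.eq_of_mul_eq_mul_right hpos ?_
  rw [show q + (e + 1) - 1 = q + e by omega, Nat.add_sub_cancel]
  calc _ = ((N + q).choose q * q.factorial * N.factorial) *
        ((N - (e + 1)).factorial * N.descFactorial (e + 1)) := by ring
    _ = (N + q).factorial * N.factorial := by rw [hA, hB]
    _ = ((N + q).choose (q + (e + 1)) * ((q + (e + 1)) *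
        ((q + e).choose q * q.factorial * e.factorial)) * (N - (e + 1)).factorial) *
          N.factorial := by rw [hC, ← hF, hE]
    _ = _ := by ring

/-- The tail bound for mixtures of beta distributions that are determined by their moments. -/
lemma sum_integral_tail_le {d N q : ℕ} (hd : 1 ≤ d) (hN : d ≤ N) {μ : ℕ → Measure ℝ}
    [∀ k, IsFiniteMeasure (μ k)]
    (hμ : ∀ k ∈ Finset.Icc 1 d, μ k (Set.Icc 0 1)ᶜ = 0)
    (h : ∀ m : ℕ, 1 ≤ m →
      ∑ k ∈ Finset.Icc 1 d, (m.choose k : ℝ) * ∫ t, t ^ (m - k) ∂μ k = 1)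
    {a : ℝ} (ha : a ∈ Set.Icc (0 : ℝ) 1) :
    ((N + q).choose q : ℝ) * ∑ k ∈ Finset.Icc 1 d, (N.choose k : ℝ) *
        ∫ t in Set.Iio a, t ^ (N - k) * (1 - t) ^ q ∂μ k ≤
      ((q + d - 1).choose q : ℝ) * ∑ i ∈ Finset.range (q + d),
        ((N + q).choose i : ℝ) * a ^ (N + q - i) * (1 - a) ^ i := by
  set c : ℝ := ((N + q).choose q : ℝ) with hc
  have hc0 : 0 ≤ c := by positivity
  -- `g` is `c * (1 - t) ^ q` times the `d`-th derivative of `t ^ N`, and `ω` is the kernel of the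
  -- `d`-fold antiderivative evaluated at one.
  let g : ℝ → ℝ := fun t => c * (1 - t) ^ q * ((N.descFactorial d : ℝ) * t ^ (N - d))
  let ω : ℝ → ℝ := fun t => (1 - t) ^ (d - 1) / ((d - 1).factorial : ℝ)
  have hint : ∫ t in (0 : ℝ)..a, ω t * g t = ((q + d - 1).choose q : ℝ) *
      ∑ i ∈ Finset.range (q + d), ((N + q).choose i : ℝ) * a ^ (N + q - i) * (1 - a) ^ i := by
    rw [← integral_pow_mul_one_sub_pow (by omega), ← intervalIntegral.integral_const_mul]
    refine intervalIntegral.integral_congr fun t _ => ?_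
    have hconst : c * (N.descFactorial d : ℝ) = ((q + d - 1).choose q : ℝ) *
        (((q + d : ℕ) : ℝ) * ((N + q).choose (q + d) : ℝ)) * ((d - 1).factorial : ℝ) := by
      rw [hc]
      exact_mod_cast choose_mul_descFactorial hd hN
    have hf : ((d - 1).factorial : ℝ) ≠ 0 := by positivity
    simp only [ω, g]
    rw [show N + q - (q + d) = N - d by omega, show q + d - 1 = q + (d - 1) by omega, pow_add]
    rw [show q + d - 1 = q + (d - 1) by omega] at hconst
    field_simp
    linear_combination (1 - t) ^ (d - 1) * (1 - t) ^ q * t ^ (N - d) * hconst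
  refine le_of_forall_pos_le_add fun ε hε => ?_
  obtain ⟨r, hr0, hrg, hrint⟩ := exists_polynomial_majorant (g := g) (ω := ω) (by fun_prop)
    (by fun_prop) ha
    (fun t ht => by have := sub_nonneg.2 ht.2; have := ht.1; positivity)
    (fun t ht => by have := sub_nonneg.2 ht.2; positivity) hε
  set p := Polynomial.antideriv^[d] r with hp
  have hp0 : p.coeff 0 = 0 := by
    obtain ⟨e, rfl⟩ := Nat.exists_eq_add_of_le' hd
    rw [hp, Function.iterate_succ_apply', Polynomial.coeff_zero_antideriv]
  have hp1 : p.eval 1 ≤ (∫ t in (0 : ℝ)..a, ω t * g t) + ε := by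
    obtain ⟨e, rfl⟩ := Nat.exists_eq_add_of_le' hd
    rw [hp, Polynomial.eval_one_iterate_antideriv]
    exact hrint
  have hhasse : ∀ k, ∀ t, (k.factorial : ℝ) * (Polynomial.hasseDeriv k p).eval t =
      (Polynomial.derivative^[k] p).eval t := by
    intro k t
    have := congrFun (Polynomial.factorial_smul_hasseDeriv (R := ℝ) k) p
    rw [← this, LinearMap.smul_apply, Polynomial.eval_smul, nsmul_eq_mul]
  -- Dual feasibility: the normalized derivatives of `p` dominate the truncated integrands.
  have hge : ∀ k ∈ Finset.Icc 1 d, ∀ t ∈ Set.Icc (0 : ℝ) 1,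
      (Set.Iio a).indicator (fun t => c * ((N.choose k : ℝ) * (t ^ (N - k) * (1 - t) ^ q))) t ≤
        (Polynomial.hasseDeriv k p).eval t := by
    intro k hk t ht
    have hkd := (Finset.mem_Icc.1 hk).2
    have hfac : (0 : ℝ) < k.factorial := by positivity
    rw [← mul_le_mul_iff_right₀ hfac, hhasse, hp, Polynomial.derivative_iterate_antideriv _ hkd]
    by_cases hta : t < a
    · rw [Set.indicator_of_mem (show t ∈ Set.Iio a from hta)]
      -- For `s ≤ t` one has `(1 - t) ^ q ≤ (1 - s) ^ q`, so this factor can be frozen at `t` before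
      -- integrating `d - k` times from zero.
      have := Polynomial.eval_iterate_antideriv_mono (b := t)
        (p := (c * (1 - t) ^ q) • Polynomial.derivative^[d] (Polynomial.X ^ N : Polynomial ℝ))
        (q := r) (fun s hs => ?_) (d - k) t ⟨ht.1, le_rfl⟩
      · rw [← Module.End.pow_apply, map_smul, Module.End.pow_apply,
          Polynomial.antideriv_iterate_derivative_X_pow hN (Nat.sub_le _ _), Nat.sub_sub_self hkd,
          Polynomial.eval_smul, Polynomial.iterate_derivative_X_pow_eq_C_mul] at this
        refine le_trans (le_of_eq ?_) this
        rw [Nat.descFactorial_eq_factorial_mul_choose]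
        simp
        ring
      · refine le_trans ?_ (hrg s ⟨hs.1, hs.2.trans hta.le⟩)
        rw [Polynomial.eval_smul, Polynomial.iterate_derivative_X_pow_eq_C_mul]
        simp only [Polynomial.eval_mul, Polynomial.eval_C, Polynomial.eval_pow, Polynomial.eval_X,
          smul_eq_mul, g]
        have hs0 := hs.1
        have h1 : (1 - t) ^ q ≤ (1 - s) ^ q :=
          pow_le_pow_left₀ (sub_nonneg.2 ht.2) (by linarith [hs.2]) q
        gcongr
    · rw [Set.indicator_of_notMem (show t ∉ Set.Iio a from hta), mul_zero]
      have := Polynomial.eval_iterate_antideriv_mono (b := 1) (p := 0) (q := r)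
        (fun s hs => by simpa using hr0 s hs) (d - k) t ht
      rw [← Module.End.pow_apply, map_zero, Polynomial.eval_zero] at this
      exact this
  rw [← hint]
  refine le_trans ?_ hp1
  rw [← sum_integral_hasseDeriv hμ h hp0, Finset.mul_sum]
  refine Finset.sum_le_sum fun k hk => ?_
  rw [← integral_const_mul, ← integral_const_mul, ← integral_indicator measurableSet_Iio]
  refine integral_mono_ae ?_ ((Polynomial.continuous _).integrable_of_compl_Icc (hμ k hk)) ?_
  · exact ((by fun_prop : Continuous _).integrable_of_compl_Icc (hμ k hk)).indicator
      measurableSet_Iio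
  · have : ∀ᵐ t ∂μ k, t ∈ Set.Icc (0 : ℝ) 1 := hμ k hk
    filter_upwards [this] with t ht using hge k hk t ht

/-! ### The removal bound for strictly convex programs. -/

namespace IsConvexProgram

variable {Z E : Type*} [NormedAddCommGroup E] [NormedSpace ℝ E] {A : Set E} {F : Z → E → ℝ}
  [MeasurableSpace Z] [ProperSpace E] [MeasurableSpace E] [BorelSpace E]
  [SecondCountableTopology E] {P : Measure Z} [IsProbabilityMeasure P]

lemma lintegral_tightLaw (hF : IsConvexProgram A F)
    (hm : ∀ w, Measurable fun z => F z w) {k : ℕ} (hk : 0 < k) (m n : ℕ) (B : Set ℝ) :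
    ∫⁻ t in B, ENNReal.ofReal t ^ m * ENNReal.ofReal (1 - t) ^ n ∂tightLaw A F P k =
      ENNReal.ofReal (∫ t in B, t ^ m * (1 - t) ^ n ∂tightLaw A F P k) := by
  have hae : ∀ᵐ t ∂(tightLaw A F P k).restrict B, t ∈ Set.Icc (0 : ℝ) 1 :=
    ae_restrict_of_ae (hF.tightLaw_compl_Icc hm hk)
  rw [ofReal_integral_eq_lintegral_ofReal]
  · refine lintegral_congr_ae ?_
    filter_upwards [hae] with t ht
    rw [ENNReal.ofReal_mul (pow_nonneg ht.1 _), ENNReal.ofReal_pow ht.1,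
      ENNReal.ofReal_pow (sub_nonneg.2 ht.2)]
  · exact ((by fun_prop : Continuous _).integrable_of_compl_Icc
      (hF.tightLaw_compl_Icc hm hk)).integrableOn
  · filter_upwards [hae] with t ht
    exact mul_nonneg (pow_nonneg ht.1 _) (pow_nonneg (sub_nonneg.2 ht.2) _)

lemma sum_integral_tightLaw [FiniteDimensional ℝ E] (hF : IsConvexProgram A F)
    (hm : ∀ w, Measurable fun z => F z w) (hnull : ∀ w r, P {y | F y w = r} = 0)
    {m : ℕ} (hm1 : 1 ≤ m) :
    ∑ k ∈ Finset.Icc 1 (Module.finrank ℝ E + 1), (m.choose k : ℝ) *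
      ∫ t, t ^ (m - k) ∂tightLaw A F P k = 1 := by
  set d := Module.finrank ℝ E + 1
  have h := hF.sum_lintegral_tightLaw hm (P := P) hm1
  have hterm : ∀ k ∈ Finset.Icc 1 m, (m.choose k : ℝ≥0∞) *
      ∫⁻ t, ENNReal.ofReal t ^ (m - k) ∂tightLaw A F P k =
      ENNReal.ofReal ((m.choose k : ℝ) * ∫ t, t ^ (m - k) ∂tightLaw A F P k) := by
    intro k hk
    have := hF.lintegral_tightLaw hm (P := P) (Finset.mem_Icc.1 hk).1 (m - k) 0 Set.univ
    simp only [pow_zero, mul_one, Measure.restrict_univ] at this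
    rw [this, ENNReal.ofReal_mul (by positivity), ENNReal.ofReal_natCast]
  have hnn : ∀ k ∈ Finset.Icc 1 m,
      0 ≤ (m.choose k : ℝ) * ∫ t, t ^ (m - k) ∂tightLaw A F P k := by
    intro k hk
    refine mul_nonneg (by positivity) (integral_nonneg_of_ae ?_)
    have hae : ∀ᵐ t ∂tightLaw A F P k, t ∈ Set.Icc (0 : ℝ) 1 :=
      hF.tightLaw_compl_Icc hm (Finset.mem_Icc.1 hk).1
    filter_upwards [hae] with t ht using pow_nonneg ht.1 _
  rw [Finset.sum_congr rfl hterm, ← ENNReal.ofReal_sum_of_nonneg hnn, ENNReal.ofReal_eq_one] at h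
  -- Both ranges are extended to `max m d`: beyond `m` the binomial coefficients vanish, and beyond
  -- `d` the laws vanish.
  have h1 : ∑ k ∈ Finset.Icc 1 m, (m.choose k : ℝ) * ∫ t, t ^ (m - k) ∂tightLaw A F P k =
      ∑ k ∈ Finset.Icc 1 (max m d), (m.choose k : ℝ) * ∫ t, t ^ (m - k) ∂tightLaw A F P k := by
    refine Finset.sum_subset (Finset.Icc_subset_Icc_right (le_max_left _ _)) fun k hk hk' => ?_
    rw [Finset.mem_Icc] at hk hk'
    rw [Nat.choose_eq_zero_of_lt (by omega), Nat.cast_zero, zero_mul]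
  have h2 : ∑ k ∈ Finset.Icc 1 d, (m.choose k : ℝ) * ∫ t, t ^ (m - k) ∂tightLaw A F P k =
      ∑ k ∈ Finset.Icc 1 (max m d), (m.choose k : ℝ) * ∫ t, t ^ (m - k) ∂tightLaw A F P k := by
    refine Finset.sum_subset (Finset.Icc_subset_Icc_right (le_max_right _ _)) fun k hk hk' => ?_
    rw [Finset.mem_Icc] at hk hk'
    rw [hF.tightLaw_eq_zero hm hnull (by omega), integral_zero_measure, mul_zero]
  rw [h2, ← h1, h]

/-- The probability that removing some `q` of the `K` samples, all of them violated by the resulting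
solution, leads to a solution whose slack set has probability less than `a`. -/
lemma measure_exists_removed_le_sum [FiniteDimensional ℝ E] (hF : IsConvexProgram A F)
    (hm : ∀ w, Measurable fun z => F z w) (hnull : ∀ w r, P {y | F y w = r} = 0) {K q : ℕ}
    (hK : q + (Module.finrank ℝ E + 1) ≤ K) {a : ℝ} (ha : a ∈ Set.Icc (0 : ℝ) 1) :
    (Measure.pi fun _ : Fin K => P) {z | ∃ Q : Finset (Fin K), Q.card = q ∧
        (∀ j ∈ Q, z j ∉ slackSet A F (z '' (Qᶜ : Finset (Fin K)))) ∧
        P.real (slackSet A F (z '' (Qᶜ : Finset (Fin K)))) < a} ≤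
      ENNReal.ofReal (((q + Module.finrank ℝ E).choose q : ℝ) *
        ∑ i ∈ Finset.range (q + (Module.finrank ℝ E + 1)),
          (K.choose i : ℝ) * a ^ (K - i) * (1 - a) ^ i) := by
  obtain ⟨N, rfl⟩ : ∃ N, K = N + q := ⟨K - q, by omega⟩
  set d := Module.finrank ℝ E + 1 with hd
  have hμ : ∀ k ∈ Finset.Icc 1 d, tightLaw A F P k (Set.Icc 0 1)ᶜ = 0 := fun k hk =>
    hF.tightLaw_compl_Icc hm (Finset.mem_Icc.1 hk).1
  have htail := sum_integral_tail_le (q := q) (N := N) (d := d) (μ := tightLaw A F P) (by omega)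
    (by omega) hμ (fun m hm1 => hF.sum_integral_tightLaw hm hnull hm1) ha
  refine (hF.measure_exists_removed_le hm (by omega) a).trans ?_
  refine le_trans (le_of_eq ?_) (ENNReal.ofReal_le_ofReal htail)
  rw [ENNReal.ofReal_mul (by positivity), ENNReal.ofReal_natCast, Nat.add_sub_cancel,
    ENNReal.ofReal_sum_of_nonneg]
  · congr 1
    have hsub : ∑ k ∈ Finset.Icc 1 d, (N.choose k : ℝ≥0∞) * ∫⁻ t in Set.Iio a,
          ENNReal.ofReal t ^ (N - k) * ENNReal.ofReal (1 - t) ^ q ∂tightLaw A F P k =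
        ∑ k ∈ Finset.Icc 1 N, (N.choose k : ℝ≥0∞) * ∫⁻ t in Set.Iio a,
          ENNReal.ofReal t ^ (N - k) * ENNReal.ofReal (1 - t) ^ q ∂tightLaw A F P k := by
      refine Finset.sum_subset (Finset.Icc_subset_Icc_right (by omega)) fun k hk hk' => ?_
      rw [Finset.mem_Icc] at hk hk'
      rw [hF.tightLaw_eq_zero hm hnull (by omega), Measure.restrict_zero, lintegral_zero_measure,
        mul_zero]
    rw [← hsub]
    refine Finset.sum_congr rfl fun k hk => ?_
    rw [hF.lintegral_tightLaw hm (Finset.mem_Icc.1 hk).1, ENNReal.ofReal_mul (by positivity),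
      ENNReal.ofReal_natCast]
  · intro k hk
    refine mul_nonneg (by positivity) (integral_nonneg_of_ae (ae_restrict_of_ae ?_))
    have hae : ∀ᵐ t ∂tightLaw A F P k, t ∈ Set.Icc (0 : ℝ) 1 := hμ k hk
    filter_upwards [hae] with t ht
    exact mul_nonneg (pow_nonneg ht.1 _) (pow_nonneg (sub_nonneg.2 ht.2) _)

end IsConvexProgram

/-! ### Perturbation to strictly convex functions without atoms. -/

/-- A perturbation of the functions `f y` by a random shift and a multiple of `t`, both small for
large `n`. -/
noncomputable def perturbed {Y E : Type*} (f : Y → E → ℝ) (t : E → ℝ) (n : ℕ)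
    (z : Y × unitInterval) (w : E) : ℝ :=
  f z.1 w - (1 / ((n : ℝ) + 1)) ^ 2 * (z.2 : ℝ) + 1 / ((n : ℝ) + 1) * t w

lemma measurable_perturbed {Y E : Type*} [MeasurableSpace Y] {f : Y → E → ℝ} {t : E → ℝ}
    (hm : ∀ w, Measurable fun y => f y w) (n : ℕ)
    (w : E) : Measurable fun z => perturbed f t n z w := by
  unfold perturbed
  exact (((hm w).comp measurable_fst).sub
    (measurable_const.mul (measurable_subtype_coe.comp measurable_snd))).add_const _

/-- For fixed `y` the perturbed value is injective in the label, so at most one label attains `r`.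
-/
lemma measure_perturbed_eq {Y E : Type*} [MeasurableSpace Y] {f : Y → E → ℝ} {t : E → ℝ}
    (hm : ∀ w, Measurable fun y => f y w) (n : ℕ)
    (P : Measure Y) [IsProbabilityMeasure P] (w : E) (r : ℝ) :
    (P.prod volume) {z : Y × unitInterval | perturbed f t n z w = r} = 0 := by
  have hms : MeasurableSet {z : Y × unitInterval | perturbed f t n z w = r} :=
    measurable_perturbed hm n w (measurableSet_singleton r)
  rw [Measure.prod_apply hms, lintegral_eq_zero_iff (measurable_measure_prodMk_left hms)]
  refine Filter.Eventually.of_forall fun y => Set.Subsingleton.measure_zero ?_ _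
  intro θ hθ θ' hθ'
  have h : perturbed f t n (y, θ) w = perturbed f t n (y, θ') w := hθ.trans hθ'.symm
  have hpos : (0 : ℝ) < (1 / ((n : ℝ) + 1)) ^ 2 := by positivity
  simp only [perturbed] at h
  have h2 : (1 / ((n : ℝ) + 1)) ^ 2 * (θ : ℝ) = (1 / ((n : ℝ) + 1)) ^ 2 * (θ' : ℝ) := by linarith
  exact Subtype.ext (mul_left_cancel₀ hpos.ne' h2)

section Perturbed

variable {Y E : Type*} [NormedAddCommGroup E] [NormedSpace ℝ E] {A : Set E} {f : Y → E → ℝ}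
  {t : E → ℝ}

lemma isBounded_sublevel {E : Type*} [NormedAddCommGroup E] {t : E → ℝ}
    (ht' : Filter.Tendsto t (Filter.cocompact E) Filter.atTop) (M : ℝ) :
    Bornology.IsBounded {w | t w ≤ M} := by
  have h := ht'.eventually (Filter.eventually_gt_atTop M)
  obtain ⟨C, hC, hsub⟩ := Filter.mem_cocompact.1 h
  refine hC.isBounded.subset fun w hw => ?_
  by_contra hwC
  have h1 : M < t w := hsub hwC
  have h2 : t w ≤ M := hw
  exact h1.not_ge h2

/-- The multiple of `t` supplies strict convexity. As `f` is nonnegative on `A` and the shift is at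
most one, growth of `t` bounds the sublevel sets. -/
lemma isConvexProgram_perturbed (hA : IsClosed A) (hAne : A.Nonempty) (hAc : Convex ℝ A)
    (hf : ∀ y, ConvexOn ℝ Set.univ (f y)) (hfc : ∀ y, Continuous (f y))
    (hf0 : ∀ y, ∀ w ∈ A, 0 ≤ f y w) (ht : StrictConvexOn ℝ Set.univ t) (htc : Continuous t)
    (ht' : Filter.Tendsto t (Filter.cocompact E) Filter.atTop) (n : ℕ) :
    IsConvexProgram A (perturbed f t n) where
  isClosed := hA
  nonempty := hAne
  strictConvexOn z := by
    refine ⟨hAc, fun w _ w' _ hne a b ha hb hab => ?_⟩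
    have h1 := (hf z.1).2 (Set.mem_univ w) (Set.mem_univ w') ha.le hb.le hab
    have h2 := ht.2 (Set.mem_univ w) (Set.mem_univ w') hne ha hb hab
    have h3 := mul_lt_mul_of_pos_left h2 (Nat.one_div_pos_of_nat (α := ℝ) (n := n))
    simp only [perturbed, smul_eq_mul] at *
    obtain rfl : b = 1 - a := by linarith
    nlinarith
  continuous z := by
    have := hfc z.1
    unfold perturbed
    fun_prop
  isBounded z M := by
    refine (isBounded_sublevel ht' ((M + 1) * (n + 1))).subset fun w hw => ?_
    have h1 := hf0 z.1 w hw.1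
    have h2 := hw.2
    simp only [perturbed] at h2
    have hpos : (0 : ℝ) < n + 1 := by positivity
    have h3 : (1 / ((n : ℝ) + 1)) ^ 2 * (z.2 : ℝ) ≤ 1 := by
      refine mul_le_one₀ (pow_le_one₀ (by positivity) ?_) z.2.2.1 z.2.2.2
      rw [div_le_one hpos]
      linarith
    have h4 : 1 / ((n : ℝ) + 1) * t w ≤ M + 1 := by linarith
    change t w ≤ _
    rwa [one_div, inv_mul_le_iff₀ hpos, mul_comm] at h4

end Perturbed

/-! ### Convergence of the perturbed solutions. -/

/-- The point `w` minimizes `t` among the minimizers in `A` of the maximum of the functions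
`f (y k)`, `k ∈ R`, the minimal value is `τ`, and the functions `f (y k)`, `k ∈ R'`, do not
exceed it at `w`. -/
structure IsLexMinimax {Y E ι : Type*} (A : Set E) (f : Y → E → ℝ) (t : E → ℝ) (y : ι → Y)
    (R R' : Finset ι) (w : E) (τ : ℝ) : Prop where
  mem : w ∈ A
  subset : R ⊆ R'
  le : ∀ k ∈ R', f (y k) w ≤ τ
  exists_ge : ∀ v ∈ A, ∃ k ∈ R, τ ≤ f (y k) v
  le_of_forall_le : ∀ v ∈ A, (∀ k ∈ R, f (y k) v ≤ τ) → t w ≤ t v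

namespace IsLexMinimax

open Filter

variable {Y E ι : Type*} {A : Set E}
  {f : Y → E → ℝ} {t : E → ℝ} {y : ι → Y} {R R' : Finset ι} {w : E} {τ : ℝ}
  {θ : ι → unitInterval} {p : ℕ → E × ℝ}

/-- With `δ = 1 / (n + 1)`, the shift has order `δ ^ 2` and the multiple of `t` has order `δ`.
Dividing by `δ` leaves an error `δ` in the comparison of `t`, so in the limit `t`, and not the
labels, decides between the minimizers. -/
lemma perturbed_bounds (h : IsLexMinimax A f t y R R' w τ)
    (hp : ∀ n, IsMinimax A (perturbed f t n) ((fun k => (y k, θ k)) '' (R' : Set ι)) (p n))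
    (n : ℕ) :
    (p n).2 ≤ τ + 1 / ((n : ℝ) + 1) * t w ∧
      τ - (1 / ((n : ℝ) + 1)) ^ 2 + 1 / ((n : ℝ) + 1) * t (p n).1 ≤ (p n).2 ∧
      t (p n).1 ≤ t w + 1 / ((n : ℝ) + 1) := by
  have hδ : (0 : ℝ) < 1 / ((n : ℝ) + 1) := Nat.one_div_pos_of_nat
  set δ := 1 / ((n : ℝ) + 1) with hδdef
  have h1 : (p n).2 ≤ τ + δ * t w := by
    obtain ⟨_, ⟨k, hk, rfl⟩, hle⟩ := (hp n).exists_ge w h.mem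
    have h2 := h.le k hk
    have h3 : 0 ≤ δ ^ 2 * (θ k : ℝ) := mul_nonneg (sq_nonneg _) (θ k).2.1
    simp only [perturbed, ← hδdef] at hle
    linarith
  have h2 : τ - δ ^ 2 + δ * t (p n).1 ≤ (p n).2 := by
    obtain ⟨k, hk, hle⟩ := h.exists_ge _ (hp n).mem
    have h3 := (hp n).le _ ⟨k, h.subset hk, rfl⟩
    have h4 : δ ^ 2 * (θ k : ℝ) ≤ δ ^ 2 := mul_le_of_le_one_right (sq_nonneg _) (θ k).2.2
    simp only [perturbed, ← hδdef] at h3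
    linarith
  refine ⟨h1, h2, ?_⟩
  have h3 : δ * t (p n).1 ≤ δ * (t w + δ) := by nlinarith
  exact le_of_mul_le_mul_left h3 hδ

variable [NormedAddCommGroup E]

lemma tendsto_perturbed_snd (h : IsLexMinimax A f t y R R' w τ) (htc : Continuous t)
    (ht' : Tendsto t (cocompact E) atTop)
    (hp : ∀ n, IsMinimax A (perturbed f t n) ((fun k => (y k, θ k)) '' (R' : Set ι)) (p n)) :
    Tendsto (fun n => (p n).2) atTop (nhds τ) := by
  obtain ⟨v₀, hv₀⟩ := htc.exists_forall_le ht'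
  obtain ⟨m, hm⟩ : ∃ m, ∀ v, m ≤ t v := ⟨t v₀, hv₀⟩
  have hδ := tendsto_one_div_add_atTop_nhds_zero_nat (𝕜 := ℝ)
  have hlow : Tendsto (fun n : ℕ => τ - (1 / ((n : ℝ) + 1)) ^ 2 + 1 / ((n : ℝ) + 1) * m) atTop
      (nhds (τ - 0 ^ 2 + 0 * m)) := ((hδ.pow 2).const_sub τ).add (hδ.mul_const m)
  have hup : Tendsto (fun n : ℕ => τ + 1 / ((n : ℝ) + 1) * t w) atTop (nhds (τ + 0 * t w)) :=
    (hδ.mul_const (t w)).const_add τ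
  simp only [ne_eq, OfNat.ofNat_ne_zero, not_false_eq_true, zero_pow, sub_zero, zero_mul,
    add_zero] at hlow hup
  refine tendsto_of_tendsto_of_tendsto_of_le_of_le hlow hup (fun n => ?_) fun n =>
    (h.perturbed_bounds hp n).1
  have h1 := (h.perturbed_bounds hp n).2.1
  have h2 := mul_le_mul_of_nonneg_left (hm (p n).1) (Nat.one_div_pos_of_nat (α := ℝ) (n := n)).le
  simp only
  linarith

variable [NormedSpace ℝ E]

lemma eq_of_le (h : IsLexMinimax A f t y R R' w τ) (hAc : Convex ℝ A)
    (hf : ∀ y, ConvexOn ℝ Set.univ (f y)) (ht : StrictConvexOn ℝ Set.univ t) {v : E}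
    (hv : v ∈ A) (hfv : ∀ k ∈ R, f (y k) v ≤ τ) (htv : t v ≤ t w) : v = w := by
  by_contra hne
  have ha : (0 : ℝ) < 1 / 2 := by norm_num
  have hab : (1 / 2 : ℝ) + 1 / 2 = 1 := by norm_num
  have h1 := h.le_of_forall_le _ (hAc hv h.mem ha.le ha.le hab) fun k hk => by
    have h2 := (hf (y k)).2 (Set.mem_univ v) (Set.mem_univ w) ha.le ha.le hab
    have h3 := hfv k hk
    have h4 := h.le k (h.subset hk)
    simp only [smul_eq_mul] at h2
    linarith
  have h2 := ht.2 (Set.mem_univ v) (Set.mem_univ w) hne ha ha hab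
  simp only [smul_eq_mul] at h2
  linarith

variable [ProperSpace E]

/-- The perturbed minimizers stay in a compact sublevel set of `t`. Each limit point is optimal for
`R` with `t` at most `t w`, hence equals `w` by strict convexity. -/
lemma tendsto_perturbed_fst (h : IsLexMinimax A f t y R R' w τ) (hA : IsClosed A)
    (hAc : Convex ℝ A) (hf : ∀ y, ConvexOn ℝ Set.univ (f y)) (hfc : ∀ y, Continuous (f y))
    (ht : StrictConvexOn ℝ Set.univ t) (htc : Continuous t) (ht' : Tendsto t (cocompact E) atTop)
    (hp : ∀ n, IsMinimax A (perturbed f t n) ((fun k => (y k, θ k)) '' (R' : Set ι)) (p n)) :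
    Tendsto (fun n => (p n).1) atTop (nhds w) := by
  have hδ := tendsto_one_div_add_atTop_nhds_zero_nat (𝕜 := ℝ)
  have hδ1 : ∀ n : ℕ, 1 / ((n : ℝ) + 1) ≤ 1 := fun n => by
    rw [div_le_one (by positivity)]
    linarith [(Nat.cast_nonneg n : (0 : ℝ) ≤ n)]
  have hcpt : IsCompact {v ∈ A | t v ≤ t w + 1} :=
    Metric.isCompact_of_isClosed_isBounded (hA.inter (isClosed_le htc continuous_const))
      ((isBounded_sublevel ht' (t w + 1)).subset fun v hv => hv.2)
  obtain ⟨v₀, hv₀⟩ := htc.exists_forall_le ht'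
  obtain ⟨m, hm⟩ : ∃ m, ∀ v, m ≤ t v := ⟨t v₀, hv₀⟩
  refine tendsto_of_subseq_tendsto fun ns hns => ?_
  obtain ⟨v, hv, φ, hφ, hlim⟩ := hcpt.tendsto_subseq (x := fun n => (p (ns n)).1) fun n =>
    ⟨(hp (ns n)).mem, ((h.perturbed_bounds hp (ns n)).2.2).trans (by linarith [hδ1 (ns n)])⟩
  have hnφ : Tendsto (fun n => ns (φ n)) atTop atTop := hns.comp hφ.tendsto_atTop
  have hvw : v = w := by
    refine h.eq_of_le hAc hf ht hv.1 (fun k hk => ?_) ?_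
    · have h1 : Tendsto (fun n => f (y k) (p (ns (φ n))).1) atTop (nhds (f (y k) v)) :=
        ((hfc (y k)).tendsto v).comp hlim
      have h2 : Tendsto (fun n => (p (ns (φ n))).2 + (1 / ((ns (φ n) : ℝ) + 1)) ^ 2 -
          1 / ((ns (φ n) : ℝ) + 1) * m) atTop (nhds (τ + 0 ^ 2 - 0 * m)) :=
        (((h.tendsto_perturbed_snd htc ht' hp).comp hnφ).add ((hδ.comp hnφ).pow 2)).sub
          ((hδ.comp hnφ).mul_const m)
      simp only [ne_eq, OfNat.ofNat_ne_zero, not_false_eq_true, zero_pow, sub_zero, zero_mul,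
        add_zero] at h2
      refine le_of_tendsto_of_tendsto' h1 h2 fun n => ?_
      have h3 := (hp (ns (φ n))).le _ ⟨k, h.subset hk, rfl⟩
      have h4 : (1 / ((ns (φ n) : ℝ) + 1)) ^ 2 * (θ k : ℝ) ≤ (1 / ((ns (φ n) : ℝ) + 1)) ^ 2 :=
        mul_le_of_le_one_right (sq_nonneg _) (θ k).2.2
      have h5 := mul_le_mul_of_nonneg_left (hm (p (ns (φ n))).1)
        (Nat.one_div_pos_of_nat (α := ℝ) (n := ns (φ n))).le
      simp only [perturbed] at h3
      linarith
    · have h1 : Tendsto (fun n => t (p (ns (φ n))).1) atTop (nhds (t v)) :=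
        (htc.tendsto v).comp hlim
      have h2 : Tendsto (fun n => t w + 1 / ((ns (φ n) : ℝ) + 1)) atTop (nhds (t w + 0)) :=
        (hδ.comp hnφ).const_add _
      rw [add_zero] at h2
      exact le_of_tendsto_of_tendsto' h1 h2 fun n => (h.perturbed_bounds hp _).2.2
  exact ⟨φ, hvw ▸ hlim⟩

lemma eventually_notMem_slackSet (h : IsLexMinimax A f t y R R' w τ) (hA : IsClosed A)
    (hAc : Convex ℝ A) (hf : ∀ y, ConvexOn ℝ Set.univ (f y)) (hfc : ∀ y, Continuous (f y))
    (ht : StrictConvexOn ℝ Set.univ t) (htc : Continuous t) (ht' : Tendsto t (cocompact E) atTop)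
    (hp : ∀ n, IsMinimax A (perturbed f t n) ((fun k => (y k, θ k)) '' (R' : Set ι))
      (minimax A (perturbed f t n) ((fun k => (y k, θ k)) '' (R' : Set ι))))
    {z : Y × unitInterval} (hz : τ < f z.1 w) :
    ∀ᶠ n in atTop,
      z ∉ slackSet A (perturbed f t n) ((fun k => (y k, θ k)) '' (R' : Set ι)) := by
  have hδ := tendsto_one_div_add_atTop_nhds_zero_nat (𝕜 := ℝ)
  have h1 := h.tendsto_perturbed_fst hA hAc hf hfc ht htc ht' hp
  have h2 := h.tendsto_perturbed_snd htc ht' hp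
  have h3 : Tendsto (fun n : ℕ => perturbed f t n z
      (minimax A (perturbed f t n) ((fun k => (y k, θ k)) '' (R' : Set ι))).1) atTop
      (nhds (f z.1 w - 0 ^ 2 * (z.2 : ℝ) + 0 * t w)) :=
    ((((hfc z.1).tendsto w).comp h1).sub ((hδ.pow 2).mul_const _)).add
      (hδ.mul ((htc.tendsto w).comp h1))
  simp only [ne_eq, OfNat.ofNat_ne_zero, not_false_eq_true, zero_pow, sub_zero, zero_mul,
    add_zero] at h3
  filter_upwards [h2.eventually_lt h3 hz] with n hn
  exact not_lt.2 hn.le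

/-- The limit superior of the slack sets lies in `{f ≤ τ}`, since points above `τ` leave them
eventually. Continuity from above transfers the strict bound on the probability. -/
lemma eventually_measure_slackSet_lt [MeasurableSpace Y] [MeasurableSpace E] [BorelSpace E]
    [SecondCountableTopology E]
    (h : IsLexMinimax A f t y R R' w τ) (hR : R'.Nonempty)
    (hA : IsClosed A)
    (hAc : Convex ℝ A) (hf : ∀ y, ConvexOn ℝ Set.univ (f y)) (hfc : ∀ y, Continuous (f y))
    (hm : ∀ w, Measurable fun y => f y w)
    (ht : StrictConvexOn ℝ Set.univ t) (htc : Continuous t) (ht' : Tendsto t (cocompact E) atTop)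
    (hF : ∀ n, IsConvexProgram A (perturbed f t n))
    (P : Measure Y) [IsProbabilityMeasure P] {a : ℝ} (hlt : P.real {y | f y w ≤ τ} < a) :
    ∀ᶠ n in atTop, (P.prod volume).real
      (slackSet A (perturbed f t n) ((fun k => (y k, θ k)) '' (R' : Set ι))) < a := by
  have hne : Nonempty R' := ⟨⟨hR.choose, hR.choose_spec⟩⟩
  set G : ℕ → Set (Y × unitInterval) := fun n =>
    slackSet A (perturbed f t n) ((fun k => (y k, θ k)) '' (R' : Set ι)) with hG
  have hGm : ∀ n, MeasurableSet (G n) := fun n => by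
    have := (hF n).measurableSet_slackSet (measurable_perturbed hm n)
      (fun k : R' => (y k, θ k))
    rw [hG]
    simp only
    rwa [Set.image_eq_range]
  have hp := fun n => (hF n).isMinimax_minimax
    (R'.finite_toSet.image fun k => (y k, θ k)) (hR.to_set.image _)
  have hlim : Tendsto (fun n => (P.prod volume) (⋃ m ≥ n, G m)) atTop
      (nhds ((P.prod volume) (⋂ n, ⋃ m ≥ n, G m))) := by
    refine tendsto_measure_iInter_atTop (fun n => ?_) ?_ ⟨0, measure_ne_top _ _⟩
    · exact (MeasurableSet.iUnion fun m => MeasurableSet.iUnion fun _ =>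
        hGm m).nullMeasurableSet
    · intro n n' hnn'
      exact Set.biUnion_subset_biUnion_left fun m hm => le_trans hnn' hm
  have hsub : (⋂ n, ⋃ m ≥ n, G m) ⊆ {y | f y w ≤ τ} ×ˢ Set.univ := by
    intro z hz
    refine ⟨?_, Set.mem_univ _⟩
    by_contra hcon
    obtain ⟨n, hn⟩ := eventually_atTop.1
      (h.eventually_notMem_slackSet hA hAc hf hfc ht htc ht' hp (z := z) (not_le.1 hcon))
    obtain ⟨m, hm, hzm⟩ := Set.mem_iUnion₂.1 (Set.mem_iInter.1 hz n)
    exact hn m hm hzm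
  have hlt' : (P.prod volume) (⋂ n, ⋃ m ≥ n, G m) < ENNReal.ofReal a := by
    refine (measure_mono hsub).trans_lt ?_
    rw [Measure.prod_prod, measure_univ, mul_one, ← ofReal_measureReal (measure_ne_top _ _),
      ENNReal.ofReal_lt_ofReal_iff (measureReal_nonneg.trans_lt hlt)]
    exact hlt
  filter_upwards [hlim.eventually_lt_const hlt'] with n hn
  have h1 : (P.prod volume) (G n) < ENNReal.ofReal a :=
    (measure_mono (Set.subset_iUnion₂ (s := fun m (_ : m ≥ n) => G m) n le_rfl)).trans_lt hn
  rw [← ofReal_measureReal (measure_ne_top _ _),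
    ENNReal.ofReal_lt_ofReal_iff (measureReal_nonneg.trans_lt hlt)] at h1
  exact h1

end IsLexMinimax

/-! ### The scenario program as a lexicographic minimax problem. -/

namespace ParametricMC

lemma AffineCost.isClosed_admissible {S W : Type*} [Finite W] (c : AffineCost S W) :
    IsClosed {w | c.Admissible w} := by
  simp only [AffineCost.Admissible, Set.ofPred_forall]
  refine isClosed_iInter fun s => isClosed_le continuous_const ?_
  have h : ∀ w, c s w = (c s).linear w + c s 0 := fun w => by
    have := (c s).map_vadd 0 w
    rwa [vadd_eq_add, vadd_eq_add, add_zero] at this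
  exact ((LinearMap.continuous_of_finiteDimensional (c s).linear).add_const (c s 0)).congr
    fun w => (h w).symm

lemma AffineCost.convex_admissible {S W : Type*} (c : AffineCost S W) :
    Convex ℝ {w | c.Admissible w} := by
  intro w hw w' hw' a b ha hb hab s
  rw [Convex.combo_affine_apply hab]
  exact add_nonneg (mul_nonneg ha (hw s)) (mul_nonneg hb (hw' s))

variable {S V W : Type*} [Fintype S] [MeasurableSpace S] [MeasurableSingletonClass S]

lemma IsSolution.exists_isLexMinimax {D : ParametricMC S V} {G : Set S}
    (hG : D.ReachesAlmostSurely G) {κ : ℝ} {c : AffineCost S W} {t : (W → ℝ) → ℝ} {K : ℕ}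
    {U : Fin K → D.space} {R : Finset (Fin K)} {w : W → ℝ} (h : D.IsSolution G κ c t U R w) :
    ∃ τ ≤ κ, R.Nonempty ∧ IsLexMinimax {w | c.Admissible w} (D.value G c) t U R
      (Finset.univ.filter fun k => D.value G c (U k) w ≤ τ) w τ := by
  obtain ⟨⟨τ, x, hfeas, hmin⟩, htie⟩ := h
  have hmin' : ∀ v, c.Admissible v → ∀ τ', (∀ k ∈ R, D.value G c (U k) v ≤ τ' ∧
      D.value G c (U k) v ≤ κ) → τ ≤ τ' := by
    intro v hv τ' hk
    obtain ⟨x', hx'⟩ := (D.feasible_iff G hG κ c U R v τ').2 ⟨hv, hk⟩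
    exact hmin v τ' x' hx'
  obtain ⟨hw, hk⟩ := (D.feasible_iff G hG κ c U R w τ).1 ⟨x, hfeas⟩
  have hR : R.Nonempty := by
    by_contra hR
    rw [Finset.not_nonempty_iff_eq_empty] at hR
    -- Without samples `τ` is unconstrained and no minimum exists.
    have := hmin' w hw (τ - 1) (by simp [hR])
    linarith
  -- The optimal `τ` is at most the largest sample value, which obeys the threshold. Hence the
  -- threshold constraint is redundant for points with values at most `τ`.
  have hτκ : τ ≤ κ := by
    obtain ⟨k, hkR, hkmax⟩ := R.exists_max_image (fun k => D.value G c (U k) w) hR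
    exact (hmin' w hw _ fun j hj => ⟨hkmax j hj, (hk j hj).2⟩).trans (hk k hkR).2
  refine ⟨τ, hτκ, hR, hw, fun k hkR => ?_, fun k hk => (Finset.mem_filter.1 hk).2,
    fun v hv => ?_, fun v hv hle => ?_⟩
  · exact Finset.mem_filter.2 ⟨Finset.mem_univ _, (hk k hkR).1⟩
  · by_contra! hcon
    obtain ⟨k, hkR, hkmax⟩ := R.exists_max_image (fun k => D.value G c (U k) v) hR
    have := hmin' v hv _ fun j hj => ⟨hkmax j hj, (hcon j hj).le.trans hτκ⟩
    exact absurd (hcon k hkR) (not_lt.2 this)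
  · refine htie v ?_
    obtain ⟨x', hx'⟩ := (D.feasible_iff G hG κ c U R v τ).2
      ⟨hv, fun k hk => ⟨hle k hk, (hle k hk).trans hτκ⟩⟩
    exact ⟨τ, x', hx', hmin⟩

end ParametricMC

/-! ### The confidence probability and the main theorem. -/

lemma sum_choose_add (L W : ℕ) :
    ∑ q ∈ Finset.range (L + 1), (q + W).choose q = (L + W + 1).choose L := by
  induction L with
  | zero => simp
  | succ L ih =>
    rw [Finset.sum_range_succ, ih, show L + 1 + W + 1 = (L + W + 1) + 1 by ring,
      Nat.choose_succ_succ, show L + 1 + W = L + W + 1 by ring]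

lemma sum_tail_le_confidenceProb (K L W : ℕ) {ν : ℝ} (hν0 : 0 ≤ ν) (hν1 : ν ≤ 1) :
    ∑ q ∈ Finset.range (L + 1), ((q + W).choose q : ℝ) * ∑ i ∈ Finset.range (q + (W + 1)),
      (K.choose i : ℝ) * (1 - ν) ^ (K - i) * (1 - (1 - ν)) ^ i ≤ confidenceProb K L W ν := by
  have h1 := sub_nonneg.2 hν1
  rw [confidenceProb, ← sum_choose_add, Nat.cast_sum, Finset.sum_mul, sub_sub_cancel]
  refine Finset.sum_le_sum fun q hq => mul_le_mul_of_nonneg_left ?_ (by positivity)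
  have := Finset.mem_range.1 hq
  refine Finset.sum_le_sum_of_subset_of_nonneg (Finset.range_mono (by omega)) fun i _ _ => ?_
  positivity

/-- For so few samples the sum contains the whole binomial expansion of `1`. -/
lemma one_le_confidenceProb {K L W : ℕ} (hK : K ≤ L + W + 1) {ν : ℝ} (hν0 : 0 ≤ ν)
    (hν1 : ν ≤ 1) : 1 ≤ confidenceProb K L W ν := by
  have h1 := sub_nonneg.2 hν1
  have hsum : ∑ i ∈ Finset.range (K + 1), (K.choose i : ℝ) * (1 - ν) ^ (K - i) * ν ^ i = 1 := by
    have := add_pow ν (1 - ν) K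
    rw [add_sub_cancel, one_pow] at this
    refine Eq.trans (Finset.sum_congr rfl fun i _ => ?_) this.symm
    ring
  have hle : (1 : ℝ) ≤ ∑ i ∈ Finset.range (L + W + 2),
      (K.choose i : ℝ) * (1 - ν) ^ (K - i) * ν ^ i := by
    refine hsum.symm.le.trans (Finset.sum_le_sum_of_subset_of_nonneg
      (Finset.range_mono (by omega)) fun i _ _ => ?_)
    positivity
  have hch : (1 : ℝ) ≤ ((L + W + 1).choose L : ℝ) := by
    exact_mod_cast Nat.choose_pos (by omega : L ≤ L + W + 1)
  exact one_le_mul_of_one_le_of_one_le hch hle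

/-- A set of samples that, for every choice of labels, belongs to an event of small probability for
the labelled samples is contained in a measurable set of small probability. -/
lemma exists_measurable_superset_of_labelled {Y Θ ι : Type*} [MeasurableSpace Y]
    [MeasurableSpace Θ] [Fintype ι] (P : Measure Y) [IsProbabilityMeasure P] (Q : Measure Θ)
    [IsProbabilityMeasure Q] {T : Set (ι → Y × Θ)} {α : ℝ≥0∞}
    (hT : (Measure.pi fun _ : ι => P.prod Q) T ≤ α) {N : Set (ι → Y)}
    (hN : ∀ y ∈ N, ∀ θ : ι → Θ, (fun i => (y i, θ i)) ∈ T) :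
    ∃ N', MeasurableSet N' ∧ N ⊆ N' ∧ (Measure.pi fun _ : ι => P) N' ≤ α := by
  let e := MeasurableEquiv.arrowProdEquivProdArrow Y Θ ι
  set T' := e.symm ⁻¹' toMeasurable (Measure.pi fun _ : ι => P.prod Q) T
  have hT' : MeasurableSet T' := e.symm.measurable (measurableSet_toMeasurable _ _)
  have hmp := (measurePreserving_arrowProdEquivProdArrow Y Θ ι (fun _ => P) (fun _ => Q)).symm
  have hmeas : ((Measure.pi fun _ : ι => P).prod (Measure.pi fun _ : ι => Q)) T' ≤ α := by
    rw [hmp.measure_preimage (measurableSet_toMeasurable _ _).nullMeasurableSet,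
      measure_toMeasurable]
    exact hT
  have hsec := measurable_measure_prodMk_left (ν := Measure.pi fun _ : ι => Q) hT'
  -- The points whose section has full label measure; Markov's inequality bounds their probability
  -- by that of the labelled event.
  refine ⟨{y | 1 ≤ (Measure.pi fun _ : ι => Q) (Prod.mk y ⁻¹' T')},
    measurableSet_le measurable_const hsec, fun y hy => ?_, ?_⟩
  · have : Prod.mk y ⁻¹' T' = Set.univ :=
      Set.eq_univ_of_forall fun θ => subset_toMeasurable _ _ (hN y hy θ)
    change 1 ≤ (Measure.pi fun _ : ι => Q) (Prod.mk y ⁻¹' T')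
    rw [this, measure_univ]
  · have := mul_meas_ge_le_lintegral (μ := Measure.pi fun _ : ι => P) hsec 1
    rw [one_mul, ← Measure.prod_apply hT'] at this
    exact this.trans hmeas

theorem theorem4 {S V W : Type*} [Fintype S] [MeasurableSpace S] [MeasurableSingletonClass S]
    [Fintype V] [Fintype W]
    (D : ParametricMC S V) (P : Measure D.space) [IsProbabilityMeasure P]
    (G : Set S) (hG : D.ReachesAlmostSurely G) (κ : ℝ) (c : ParametricMC.AffineCost S W)
    (t : (W → ℝ) → ℝ) (ht : StrictConvexOn ℝ Set.univ t)
    (ht' : Filter.Tendsto t (Filter.cocompact (W → ℝ)) Filter.atTop)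
    (K L : ℕ) (hK : 2 ≤ K) (ν : ℝ) (hν0 : 0 ≤ ν) (hν1 : ν < 1) :
    ∃ E : Set (Fin K → D.space), MeasurableSet E ∧
      1 - confidenceProb K L (Fintype.card W) ν ≤ (Measure.pi fun _ : Fin K => P).real E ∧
      ∀ U ∈ E, ∀ w₀ w : W → ℝ, c.Admissible w₀ →
        (D.violating G κ (c.costs w₀) U).card ≤ L →
        D.IsSolution G κ c t U (Finset.univ \ D.violating G κ (c.costs w₀) U) w →
        1 - ν ≤ D.satProb P G κ (c.costs w) := by
  classical
  by_cases hAne : ∃ w, c.Admissible w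
  swap
  · exact ⟨Set.univ, MeasurableSet.univ, by
      rw [probReal_univ]
      have h1 := sub_nonneg.2 hν1.le
      have : 0 ≤ confidenceProb K L (Fintype.card W) ν := by unfold confidenceProb; positivity
      linarith, fun U _ w₀ w hw₀ => absurd ⟨w₀, hw₀⟩ hAne⟩
  -- With too few samples the confidence bound is vacuous and the empty event suffices. Otherwise `q
  -- + (W + 1) ≤ K` for all `q ≤ L`, as the removal bound requires.
  rcases Nat.lt_or_ge (L + Fintype.card W + 1) K with hKL | hKL
  swap
  · refine ⟨∅, MeasurableSet.empty, ?_, fun U hU => absurd hU (Set.notMem_empty U)⟩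
    rw [measureReal_empty]
    linarith [one_le_confidenceProb hKL hν0 hν1.le]
  set A : Set (W → ℝ) := {w | c.Admissible w} with hA
  set f := D.value G c with hf
  have htc : Continuous t := by
    rw [← continuousOn_univ]
    exact ht.convexOn.continuousOn isOpen_univ
  have hfc : ∀ u, Continuous (f u) := fun u => by
    rw [← continuousOn_univ]
    exact (D.convexOn_value G c u).continuousOn isOpen_univ
  have hfx : ∀ u, ConvexOn ℝ Set.univ (f u) := D.convexOn_value G c
  have hfm : ∀ w, Measurable fun u => f u w := D.measurable_value G c
  have hF : ∀ n, IsConvexProgram A (perturbed f t n) := isConvexProgram_perturbed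
    c.isClosed_admissible hAne c.convex_admissible hfx hfc
    (fun u w hw => (D.expectedCost_eq G hG c u hw).2) ht htc ht'
  let Bad : ℕ → ℕ → Set (Fin K → D.space × unitInterval) := fun n q =>
    {z | ∃ Q : Finset (Fin K), Q.card = q ∧
      (∀ j ∈ Q, z j ∉ slackSet A (perturbed f t n) (z '' (Qᶜ : Finset (Fin K)))) ∧
      (P.prod volume).real (slackSet A (perturbed f t n) (z '' (Qᶜ : Finset (Fin K)))) < 1 - ν}
  let B : ℕ → Set (Fin K → D.space × unitInterval) := fun n =>
    ⋃ q ∈ Finset.range (L + 1), Bad n q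
  set α := ENNReal.ofReal (confidenceProb K L (Fintype.card W) ν) with hα
  have hB : ∀ n, (Measure.pi fun _ : Fin K => P.prod volume) (B n) ≤ α := by
    intro n
    refine (measure_biUnion_finset_le _ _).trans ?_
    have h1 := sub_nonneg.2 hν1.le
    refine (Finset.sum_le_sum fun q hq => (hF n).measure_exists_removed_le_sum
      (measurable_perturbed hfm n) (fun w r => measure_perturbed_eq hfm n P w r) ?_
      ⟨h1, by linarith⟩).trans ?_
    · rw [Module.finrank_fintype_fun_eq_card]
      have := Finset.mem_range.1 hq
      omega
    · rw [Module.finrank_fintype_fun_eq_card, ← ENNReal.ofReal_sum_of_nonneg]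
      · exact ENNReal.ofReal_le_ofReal (sum_tail_le_confidenceProb K L _ hν0 hν1.le)
      · intro q _
        rw [sub_sub_cancel]
        positivity
  -- The limit inferior is an increasing union, so it inherits the uniform bound on the bad events.
  let T : Set (Fin K → D.space × unitInterval) := ⋃ n, ⋂ m ≥ n, B m
  have hT : (Measure.pi fun _ : Fin K => P.prod volume) T ≤ α := by
    have hmono : Monotone fun n => ⋂ m ≥ n, B m := fun n n' hnn' =>
      Set.biInter_subset_biInter_left fun m hm => le_trans hnn' hm
    rw [hmono.measure_iUnion]
    exact iSup_le fun n => (measure_mono (Set.iInter₂_subset n le_rfl)).trans (hB n)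
  obtain ⟨N, hN, hsub, hNα⟩ := exists_measurable_superset_of_labelled P volume hT
    (N := {U | ∃ w₀ w : W → ℝ, c.Admissible w₀ ∧
      (D.violating G κ (c.costs w₀) U).card ≤ L ∧
      D.IsSolution G κ c t U (Finset.univ \ D.violating G κ (c.costs w₀) U) w ∧
      D.satProb P G κ (c.costs w) < 1 - ν}) (by
    rintro U ⟨w₀, w, hw₀, hcard, hsol, hlt⟩ θ
    obtain ⟨τ, hτ, hR, hlex⟩ := hsol.exists_isLexMinimax hG
    set R := Finset.univ \ D.violating G κ (c.costs w₀) U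
    -- Samples removed for violating under `w₀` need not have value above `τ` at `w`. Those with
    -- value at most `τ` are put back, which keeps the solution and leaves at most `L` removed
    -- samples, now all strictly above `τ`.
    set R' : Finset (Fin K) := Finset.univ.filter fun k => D.value G c (U k) w ≤ τ with hR'
    have hR'ne : R'.Nonempty := hR.mono hlex.subset
    have hQ : R'ᶜ.card ≤ L := by
      refine (Finset.card_le_card fun k hk => ?_).trans hcard
      by_contra hkv
      exact Finset.mem_compl.1 hk (hlex.subset (Finset.mem_sdiff.2 ⟨Finset.mem_univ _, hkv⟩))
    have hlt' : P.real {u | f u w ≤ τ} < 1 - ν := by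
      refine lt_of_le_of_lt (measureReal_mono ?_ (measure_ne_top _ _)) hlt
      intro u hu
      exact (D.satisfies_iff G hG κ c u hlex.mem).2 (le_trans hu hτ)
    have hp := fun n => (hF n).isMinimax_minimax
      (R'.finite_toSet.image fun k => (U k, θ k)) (hR'ne.to_set.image _)
    have hev1 := hlex.eventually_measure_slackSet_lt (θ := θ) hR'ne c.isClosed_admissible
      c.convex_admissible hfx hfc hfm ht htc ht' hF P hlt'
    have hev2 : ∀ᶠ n in Filter.atTop, ∀ k ∈ R'ᶜ, (U k, θ k) ∉
        slackSet A (perturbed f t n) ((fun k => (U k, θ k)) '' (R' : Set (Fin K))) := by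
      rw [Filter.eventually_all_finset]
      intro k hk
      refine hlex.eventually_notMem_slackSet c.isClosed_admissible
        c.convex_admissible hfx hfc ht htc ht' hp ?_
      rw [Finset.mem_compl, hR', Finset.mem_filter] at hk
      exact not_le.1 fun h => hk ⟨Finset.mem_univ _, h⟩
    obtain ⟨n, hn⟩ := Filter.eventually_atTop.1 (hev1.and hev2)
    refine Set.mem_iUnion.2 ⟨n, Set.mem_iInter₂.2 fun m hm => ?_⟩
    refine Set.mem_biUnion (x := R'ᶜ.card) (Finset.mem_coe.2 (Finset.mem_range.2 (by omega)))
      ⟨R'ᶜ, rfl, ?_⟩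
    rw [compl_compl]
    exact ⟨(hn m hm).2, (hn m hm).1⟩)
  refine ⟨Nᶜ, hN.compl, ?_, fun U hU w₀ w hw₀ hcard hsol => ?_⟩
  · rw [probReal_compl_eq_one_sub hN]
    have h0 : 0 ≤ confidenceProb K L (Fintype.card W) ν := by
      have h1 := sub_nonneg.2 hν1.le
      unfold confidenceProb; positivity
    have := ENNReal.toReal_le_of_le_ofReal h0 hNα
    rw [measureReal_def]
    linarith
  · by_contra hcon
    exact hU (hsub ⟨w₀, w, hw₀, hcard, hsol, not_le.1 hcon⟩)
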